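/- Let $t\ge 1$ and let $k_1,\dots,k_t\ge 2$ be integers with $\max\{k_1,\dots,k_t\}\ge 3$, and put $\kappa=\sum_{i=1}^t (k_i-1)$. Let $C_{2k_1,\dots,2k_t}$ denote the graph consisting of $t$ cycles of lengths $2k_1,\dots,2k_t$ that all share one vertex and are otherwise pairwise disjoint. For $n\ge\kappa+2$ let $S^+_{n,\kappa}$ be the graph on $n$ vertices obtained from the join of the complete graph $K_\kappa$ and an independent set of $n-\kappa$ vertices by adding one edge inside the independent set. Write $\lambda(G)$ for the spectral radius of the adjacency matrix of a finite simple graph $G$, and say that $G$ contains $F$ if $G$ has a (not necessarily induced) subgraph isomorphic to $F$. Then there is an integer $N$, depending only on $k_1,\dots,k_t$, such that for every $n\ge N$: (a) every graph $G$ on $n$ vertices with $\lambda(G)\ge\lambda(S^+_{n,\kappa})$ that is not isomorphic to $S^+_{n,\kappa}$ contains $C_{2k_1,\dots,2k_t}$; (b) $S^+_{n,\kappa}$ is, up to isomorphism, the unique graph of maximum adjacency spectral radius among the $n$-vertex graphs that do not contain $C_{2k_1,\dots,2k_t}$; that is, $\mathrm{SPEX}(n,C_{2k_1,\dots,2k_t})=\{S^+_{n,\kappa}\}$.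 -/

import Mathlib

open scoped ENNReal

/-- The adjacency spectral radius of a finite graph: the largest absolute value of an eigenvalue of
its adjacency matrix. (The matrix is real symmetric, so all its eigenvalues are real.) -/
noncomputable def adjSpectralRadius {V : Type*} [Fintype V] (G : SimpleGraph V) : ℝ≥0∞ :=
  open Classical in spectralRadius ℝ (G.adjMatrix ℝ)

/-- Cycles of lengths `l i` (for `i : Fin t`), pairwise sharing exactly one common vertex.
The common vertex is `none`; the remaining `l i - 1` vertices of the `i`-th cycle, in cyclic order
starting from the centre, are `some ⟨i, 0⟩, …, some ⟨i, l i - 2⟩`. -/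
def intersectingCycles {t : ℕ} (l : Fin t → ℕ) :
    SimpleGraph (Option (Σ i : Fin t, Fin (l i - 1))) :=
  SimpleGraph.fromRel fun x y =>
    match x, y with
    | none, some ⟨i, b⟩ => b.val = 0 ∨ b.val + 2 = l i
    | some ⟨i, a⟩, some ⟨j, b⟩ => i = j ∧ a.val + 1 = b.val
    | _, none => False

/-- `S_{n,k}`: the join of a clique on the vertices `0, …, k - 1` and an independent set on the
vertices `k, …, n - 1`. -/
def splitGraph (n k : ℕ) : SimpleGraph (Fin n) :=
  SimpleGraph.fromRel fun x _ => x.val < k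

/-- `S⁺_{n,k}`: the graph `S_{n,k}` with one edge added inside its independent set, namely the edge
between the vertices `k` and `k + 1` (this presupposes `k + 2 ≤ n`). -/
def splitGraphPlus (n k : ℕ) : SimpleGraph (Fin n) :=
  splitGraph n k ⊔ SimpleGraph.fromRel fun x y => x.val = k ∧ y.val = k + 1

/-- `spex(n, F)`: the maximum adjacency spectral radius of an `F`-free graph on `n` vertices. -/
noncomputable def spex {W : Type*} (n : ℕ) (F : SimpleGraph W) : ℝ≥0∞ :=
  ⨆ G ∈ {G : SimpleGraph (Fin n) | F.Free G}, adjSpectralRadius G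

/-- `SPEX(n, F)`: the (labelled) `F`-free graphs on `n` vertices whose adjacency spectral radius is
`spex(n, F)`. -/
def SPEX {W : Type*} (n : ℕ) (F : SimpleGraph W) : Set (SimpleGraph (Fin n)) :=
  {G | F.Free G ∧ adjSpectralRadius G = spex n F}

/-!
# Spectral extremal graphs for intersecting even cycles

Let `F` be the graph of even cycles of lengths `2 * k i` through a common vertex, and let
`κ = ∑ i, (k i - 1) ≥ 2`. As there are only finitely many graphs on `n` vertices, everything follows
once a graph `G` of maximum spectral radius among the `F`-free ones is shown to be isomorphic
to `S⁺` (`iso_of_extremal`); `S⁺` itself is `F`-free because `F` minus an edge still has a matching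
of size `κ + 1` (`splitGraphPlus_free`). Let `μ` be the spectral radius of `G` and `x` a Perron
vector with largest entry `1`. Comparison with `S⁺` gives `μ² ≥ κ (n - κ)`.

*Local sparseness.* If there are many edges between a set of neighbours of `v` and another set, they
contain long alternating paths, hence disjoint ears at `v` of all the lengths needed for a copy
of `F` with centre `v`. So the number of such edges is linear in the number of vertices involved
(`sum_card_filter_adj_le`), and at most `O(n)` walks of length two start at any vertex.

*Stability.* All estimates come from the identity `μ² x v = ∑ w, codeg v w * x w`. A vertex `w` with
`x w` bounded away from `0` has degree of order at least `√n`. If many such `w` had two common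
neighbours with `v`, then long paths through them would again yield a copy of `F` at `v`
(`card_heavy_codeg_lt`). Hence among the vertices of degree `o(n)` the maximum weight `m`
satisfies `κ n m ≤ n m + o(n)`, and so `m = o(1)` (`weight_lt_of_degree_lt`). Therefore
all but boundedly many weights are negligible. As `F` is contained in the complete bipartite graph
with `κ + 1` vertices on one side, almost every vertex has at most `κ` neighbours of large
weight, and comparing with `μ² ≥ κ (n - κ)` at a vertex of weight `1` yields exactly `κ`
vertices of weight and relative degree close to `1` (`exists_dominating_set`). Call this set `S`.

*Exact structure.* If some vertices were not adjacent to all of `S`, one of them would have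
neighbours of small total weight outside `S`, and joining it to `S` instead would increase the
spectral radius without creating a copy of `F` (`adj_of_extremal`). So `S` is joined to its
complement, which then contains neither a path with two edges nor two disjoint edges
(`edge_unique_of_free`; the second uses a cycle of length at least six). Thus `G` is a subgraph
of `S⁺`, and by strict monotonicity of the spectral radius it equals `S⁺`.
-/

/-! ### Dense relations and alternating paths -/

/-- A relation between `U` and `W` with more than `D * (#U + #W)` pairs has a nonempty part in which
every vertex on either side has more than `D` partners: delete vertices with few partners
as long as there are any. -/
lemma exists_core {V : Type*} [DecidableEq V] (r : V → V → Prop) [DecidableRel r] (D : ℕ)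
    (U W : Finset V) (h : D * (U.card + W.card) < ∑ u ∈ U, (W.filter (r u)).card) :
    ∃ U' ⊆ U, ∃ W' ⊆ W, U'.Nonempty ∧ (∀ u ∈ U', D < (W'.filter (r u)).card) ∧
      ∀ w ∈ W', D < (U'.filter (r · w)).card := by
  induction hn : U.card + W.card using Nat.strong_induction_on generalizing U W with
  | _ m ih =>
    by_cases h1 : ∃ u ∈ U, (W.filter (r u)).card ≤ D
    · obtain ⟨u, hu, hud⟩ := h1
      have hc := Finset.card_erase_add_one hu
      have hs := Finset.add_sum_erase U (fun u => (W.filter (r u)).card) hu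
      obtain ⟨U', hU', W', hW', h'⟩ := ih _ (by rw [← hn, ← hc]; omega) (U.erase u) W
        (by rw [← hc] at h; ring_nf at h ⊢; omega) rfl
      exact ⟨U', hU'.trans (Finset.erase_subset _ _), W', hW', h'⟩
    by_cases h2 : ∃ w ∈ W, (U.filter (r · w)).card ≤ D
    · obtain ⟨w, hw, hwd⟩ := h2
      have hc := Finset.card_erase_add_one hw
      have e1 := Finset.sum_card_bipartiteAbove_eq_sum_card_bipartiteBelow (s := U) (t := W) r
      have e2 := Finset.sum_card_bipartiteAbove_eq_sum_card_bipartiteBelow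
        (s := U) (t := W.erase w) r
      have hs := Finset.add_sum_erase W (fun w => (U.filter (r · w)).card) hw
      simp only [Finset.bipartiteAbove, Finset.bipartiteBelow] at hs e1 e2
      obtain ⟨U', hU', W', hW', h'⟩ := ih _ (by rw [← hn, ← hc]; omega) U (W.erase w)
        (by rw [← hc, e1] at h; rw [e2]; ring_nf at h ⊢; omega) rfl
      exact ⟨U', hU', W', hW'.trans (Finset.erase_subset _ _), h'⟩
    push Not at h1 h2
    refine ⟨U, subset_rfl, W, subset_rfl, ?_, h1, h2⟩
    rw [Finset.nonempty_iff_ne_empty]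
    rintro rfl
    simp at h

/-- In a pair `U`, `W` of vertex sets in which every vertex has many neighbours on the other side
there are alternating paths of any bounded length from `U` to `U` that avoid a given
small set `X`. -/
lemma exists_alternating_path {V : Type*} [DecidableEq V] (G : SimpleGraph V) [DecidableRel G.Adj]
    (D : ℕ) (U W X : Finset V) (hU : U.Nonempty) (hUW : ∀ u ∈ U, D < (W.filter (G.Adj u)).card)
    (hWU : ∀ w ∈ W, D < (U.filter (G.Adj · w)).card) (m : ℕ) (hm : X.card + 2 * m ≤ D) :
    ∃ l : List V, l.length = 2 * m + 1 ∧ l.Nodup ∧ l.IsChain G.Adj ∧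
      (∀ a ∈ l, a ∈ U ∪ W ∧ a ∉ X) ∧ (∃ a ∈ U, l.head? = some a) ∧
      ∃ b ∈ U, l.getLast? = some b := by
  have key : ∀ (Y : Finset V) (s : Finset V), Y.card ≤ D → D < s.card → ∃ a ∈ s, a ∉ Y :=
    fun Y s h1 h2 => Finset.exists_mem_notMem_of_card_lt_card (h1.trans_lt h2)
  induction m with
  | zero =>
    obtain ⟨u, hu⟩ := hU
    obtain ⟨w, hw⟩ := Finset.card_pos.1 ((Nat.zero_le D).trans_lt (hUW u hu))
    obtain ⟨a, ha, haX⟩ := key X _ (by omega) (hWU w (Finset.mem_filter.1 hw).1)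
    have haU := (Finset.mem_filter.1 ha).1
    exact ⟨[a], by simp, by simp, by simp, by simp [haX, haU], ⟨a, haU, rfl⟩, a, haU, rfl⟩
  | succ m ih =>
    obtain ⟨l, hl, hnd, hch, hX, ⟨a, ha, hhead⟩, hlast⟩ := ih (by omega)
    have hlc : l.toFinset.card ≤ 2 * m + 1 := hl ▸ l.toFinset_card_le
    obtain ⟨w, hw, hwX⟩ := key (X ∪ l.toFinset) _
      ((Finset.card_union_le _ _).trans (by omega)) (hUW a ha)
    obtain ⟨hwW, haw⟩ := Finset.mem_filter.1 hw
    obtain ⟨u, hu, huX⟩ := key (X ∪ l.toFinset) _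
      ((Finset.card_union_le _ _).trans (by omega)) (hWU w hwW)
    obtain ⟨huU, huw⟩ := Finset.mem_filter.1 hu
    simp only [Finset.mem_union, List.mem_toFinset, not_or] at hwX huX
    obtain ⟨b, hb, hlast⟩ := hlast
    refine ⟨u :: w :: l, by simp [hl]; ring, ?_, ?_, ?_, ⟨u, huU, rfl⟩, b, hb, ?_⟩
    · simp [hnd, hwX.2, huX.2, huw.ne]
    · simp [List.isChain_cons, hch, hhead, huw, haw.symm]
    · intro b hb
      rcases List.mem_cons.1 hb with rfl | hb
      · exact ⟨Finset.mem_union_left _ huU, huX.1⟩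
      rcases List.mem_cons.1 hb with rfl | hb
      · exact ⟨Finset.mem_union_right _ hwW, hwX.1⟩
      exact hX b hb
    · simp [List.getLast?_cons, hlast]

/-! ### Finding intersecting cycles -/

/-- To prove a symmetric property of the edges of `intersectingCycles l`, it suffices to look at the
edges at the centre and at the edges along the cycles, each in one direction. -/
lemma intersectingCycles_adj_rec {t : ℕ} {l : Fin t → ℕ}
    {P : Option (Σ i : Fin t, Fin (l i - 1)) → Option (Σ i : Fin t, Fin (l i - 1)) → Prop}
    (hs : ∀ x y, P x y → P y x)
    (hc : ∀ i (b : Fin (l i - 1)), b.val = 0 ∨ b.val + 2 = l i → P none (some ⟨i, b⟩))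
    (hp : ∀ i (a b : Fin (l i - 1)), a.val + 1 = b.val → P (some ⟨i, a⟩) (some ⟨i, b⟩))
    {x y : Option (Σ i : Fin t, Fin (l i - 1))} (h : (intersectingCycles l).Adj x y) : P x y := by
  have key : ∀ x y, (match x, y with
    | none, some ⟨i, b⟩ => b.val = 0 ∨ b.val + 2 = l i
    | some ⟨i, a⟩, some ⟨j, b⟩ => i = j ∧ a.val + 1 = b.val
    | _, none => False : Prop) → P x y := by
    rintro (_ | ⟨i, a⟩) (_ | ⟨j, b⟩) h
    · exact h.elim
    · exact hc j b h
    · exact h.elim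
    · obtain ⟨rfl, h⟩ := h
      exact hp i a b h
  rw [intersectingCycles, SimpleGraph.fromRel_adj] at h
  rcases h.2 with h | h
  · exact key x y h
  · exact hs _ _ (key y x h)

lemma intersectingCycles_adj_center {t : ℕ} {l : Fin t → ℕ} (i : Fin t) (b : Fin (l i - 1))
    (h : b.val = 0 ∨ b.val + 2 = l i) : (intersectingCycles l).Adj none (some ⟨i, b⟩) := by
  rw [intersectingCycles, SimpleGraph.fromRel_adj]
  exact ⟨by simp, Or.inl h⟩

lemma intersectingCycles_adj_succ {t : ℕ} {l : Fin t → ℕ} (i : Fin t) (a b : Fin (l i - 1))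
    (h : a.val + 1 = b.val) : (intersectingCycles l).Adj (some ⟨i, a⟩) (some ⟨i, b⟩) := by
  rw [intersectingCycles, SimpleGraph.fromRel_adj]
  refine ⟨fun e => ?_, Or.inl ⟨rfl, h⟩⟩
  simp only [Option.some.injEq, Sigma.mk.injEq, heq_eq_eq, true_and] at e
  simp [e] at h

/-- A map out of `intersectingCycles l` is a copy as soon as it is injective and respects the edges
at the centre and the edges along the cycles. -/
lemma intersectingCycles_isContained_of_injective {V : Type*} {G : SimpleGraph V} {t : ℕ}
    {l : Fin t → ℕ} (f : Option (Σ i : Fin t, Fin (l i - 1)) → V) (hf : Function.Injective f)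
    (hc : ∀ i (b : Fin (l i - 1)), b.val = 0 ∨ b.val + 2 = l i → G.Adj (f none) (f (some ⟨i, b⟩)))
    (hp : ∀ i (a b : Fin (l i - 1)), a.val + 1 = b.val →
      G.Adj (f (some ⟨i, a⟩)) (f (some ⟨i, b⟩))) :
    (intersectingCycles l).IsContained G :=
  ⟨⟨⟨f, fun h => intersectingCycles_adj_rec (P := fun x y => G.Adj (f x) (f y))
    (fun _ _ h => h.symm) hc hp h⟩, hf⟩⟩

/-- A path `p` on `m` vertices that avoids `X` and has both ends adjacent to `v`; together with `v`
it forms a cycle of length `m + 1`. -/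
def IsEar {V : Type*} (G : SimpleGraph V) (v : V) (X : Finset V) (m : ℕ) (p : List V) : Prop :=
  p.length = m ∧ p.Nodup ∧ p.IsChain G.Adj ∧ (∀ a ∈ p, a ∉ X) ∧
    (∀ a ∈ p.head?, G.Adj v a) ∧ ∀ a ∈ p.getLast?, G.Adj v a

/-- If ears of all the required lengths at `v` can be found outside any bounded set, then choosing
them one after the other gives intersecting cycles with centre `v`. -/
lemma intersectingCycles_isContained_of_ears {V : Type*} [DecidableEq V] {G : SimpleGraph V}
    {t : ℕ} {l : Fin t → ℕ} (v : V)
    (h : ∀ X : Finset V, v ∈ X → X.card ≤ 1 + ∑ i, (l i - 1) → ∀ i, ∃ p, IsEar G v X (l i - 1) p) :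
    (intersectingCycles l).IsContained G := by
  have key : ∀ s : Finset (Fin t), ∃ p : Fin t → List V, (∀ i ∈ s, IsEar G v {v} (l i - 1) (p i)) ∧
      ∀ i ∈ s, ∀ j ∈ s, i ≠ j → ∀ a ∈ p i, a ∉ p j := by
    intro s
    induction s using Finset.induction_on with
    | empty => exact ⟨fun _ => [], by simp, by simp⟩
    | insert i s his ih =>
      obtain ⟨p, hp, hd⟩ := ih
      obtain ⟨q, hq⟩ := h (insert v (s.biUnion fun j => (p j).toFinset)) (by simp) (by
        refine (Finset.card_insert_le _ _).trans ?_
        rw [add_comm]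
        refine Nat.add_le_add_left (Finset.card_biUnion_le.trans ?_) _
        refine (Finset.sum_le_sum fun j hj => (List.toFinset_card_le _).trans (hp j hj).1.le).trans ?_
        exact Finset.sum_le_sum_of_subset (Finset.subset_univ _)) i
      have hne : ∀ j ∈ s, j ≠ i := fun j hj e => his (e ▸ hj)
      refine ⟨Function.update p i q, ?_, ?_⟩
      · intro j hj
        rcases Finset.mem_insert.1 hj with rfl | hj
        · rw [Function.update_self]
          refine ⟨hq.1, hq.2.1, hq.2.2.1, fun a ha hav => hq.2.2.2.1 a ha ?_, hq.2.2.2.2⟩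
          exact Finset.mem_insert.2 (Or.inl (by simpa using hav))
        · rw [Function.update_of_ne (hne j hj)]
          exact hp j hj
      · have hqp : ∀ j ∈ s, ∀ a ∈ q, a ∉ p j := fun j hj a ha haj =>
          hq.2.2.2.1 a ha (Finset.mem_insert_of_mem
            (Finset.mem_biUnion.2 ⟨j, hj, List.mem_toFinset.2 haj⟩))
        intro j hj j' hj' hjj' a ha
        rcases Finset.mem_insert.1 hj with h1 | h1 <;> rcases Finset.mem_insert.1 hj' with h2 | h2
        · exact absurd (h1.trans h2.symm) hjj'
        · rw [h1, Function.update_self] at ha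
          rw [Function.update_of_ne (hne _ h2)]
          exact hqp _ h2 a ha
        · rw [Function.update_of_ne (hne _ h1)] at ha
          rw [h2, Function.update_self]
          exact fun h' => hqp _ h1 a h' ha
        · rw [Function.update_of_ne (hne _ h1)] at ha
          rw [Function.update_of_ne (hne _ h2)]
          exact hd j h1 j' h2 hjj' a ha
  obtain ⟨p, hp, hd⟩ := key Finset.univ
  have hlen : ∀ i, (p i).length = l i - 1 := fun i => (hp i (Finset.mem_univ i)).1
  let g : (Σ i : Fin t, Fin (l i - 1)) → V := fun x => (p x.1)[x.2.val]'(by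
    rw [hlen]; exact x.2.2)
  have hgv : ∀ x, g x ≠ v := fun x e =>
    (hp x.1 (Finset.mem_univ _)).2.2.2.1 (g x) (List.getElem_mem _) (by simp [e])
  refine intersectingCycles_isContained_of_injective (fun x => x.elim v g) ?_ ?_ ?_
  · rintro (_ | ⟨i, a⟩) (_ | ⟨j, b⟩) e
    · rfl
    · exact absurd e.symm (hgv _)
    · exact absurd e (hgv _)
    · simp only [Option.elim_some] at e
      by_cases hij : i = j
      · subst hij
        have := (List.Nodup.getElem_inj_iff (hp i (Finset.mem_univ _)).2.1).1 e
        simpa [Fin.ext_iff] using this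
      · have hm : g ⟨i, a⟩ ∈ p i := List.getElem_mem _
        exact absurd (e ▸ List.getElem_mem _) (hd i (by simp) j (by simp) hij _ hm)
  · rintro i b (hb | hb)
    · refine (hp i (Finset.mem_univ _)).2.2.2.2.1 _ ?_
      have h0 : 0 < (p i).length := by rw [hlen]; exact (Nat.zero_le _).trans_lt b.2
      simp only [g, hb, Option.elim_some, List.head?_eq_getElem?, Option.mem_def]
      exact List.getElem?_eq_getElem h0
    · refine (hp i (Finset.mem_univ _)).2.2.2.2.2 _ ?_
      have h2 : b.val = (p i).length - 1 := by rw [hlen]; omega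
      have := b.2
      simp only [g, h2, Option.elim_some, List.getLast?_eq_getElem?, Option.mem_def]
      exact List.getElem?_eq_getElem _
  · intro i a b hab
    have := List.isChain_iff_getElem.1 (hp i (Finset.mem_univ _)).2.2.1 a.val
      (by rw [hlen, hab]; exact b.2)
    simpa [g, ← hab] using this

/-- In a graph without intersecting cycles, the number of edges between a set of neighbours of a
vertex `v` and any set `W` is linear in the sizes of the two sets: otherwise alternating paths in a
dense part provide ears at `v`. -/
lemma sum_card_filter_adj_le {V : Type*} [DecidableEq V] {G : SimpleGraph V} [DecidableRel G.Adj]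
    {t : ℕ} {k : Fin t → ℕ} (hk : ∀ i, 2 ≤ k i)
    (hG : (intersectingCycles fun i => 2 * k i).Free G) (v : V) (U W : Finset V)
    (hU : ∀ u ∈ U, G.Adj v u) :
    ∑ u ∈ U, (W.filter (G.Adj u)).card ≤
      2 * (1 + ∑ i, (2 * k i - 1)) * (U.card + W.card) := by
  by_contra! h
  obtain ⟨U', hU', W', -, hne, h1, h2⟩ := exists_core G.Adj _ U W h
  refine hG (intersectingCycles_isContained_of_ears v fun X _ hX i => ?_)
  have hi : 2 * k i - 1 ≤ ∑ i, (2 * k i - 1) :=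
    Finset.single_le_sum (f := fun i => 2 * k i - 1) (by simp) (Finset.mem_univ i)
  have hki := hk i
  obtain ⟨p, hp, hnd, hch, hpX, ⟨a, ha, hhead⟩, b, hb, hlast⟩ :=
    exists_alternating_path G _ U' W' X hne h1 h2 (k i - 1) (by omega)
  refine ⟨p, by omega, hnd, hch, fun a ha => (hpX a ha).2, ?_, ?_⟩
  · simpa [hhead] using hU a (hU' ha)
  · simpa [hlast] using hU b (hU' hb)

/-! ### Intersecting cycles in joins -/

/-- Let `T` be an independent set of `A`, and let `S` be a set of `#T` vertices of `G` completely
joined to a large set `C`. If the subgraph of `A` outside `T`, which lives on `P`, can be found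
in `C`, then `G` contains `A`. -/
lemma isContained_of_join {W V : Type*} [Fintype W] [DecidableEq W] [DecidableEq V]
    {A : SimpleGraph W} {G : SimpleGraph V} (T P : Finset W) (S C : Finset V) (g : W → V)
    (hTS : T.card = S.card) (hT : ∀ a ∈ T, ∀ b ∈ T, ¬A.Adj a b)
    (hSC : ∀ s ∈ S, ∀ c ∈ C, G.Adj s c)
    (hP : ∀ a b, A.Adj a b → a ∉ T → b ∉ T → a ∈ P ∧ b ∈ P ∧ G.Adj (g a) (g b))
    (hgC : ∀ a ∈ P, g a ∈ C) (hg : Set.InjOn g P) (hC : Fintype.card W ≤ C.card) :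
    A.IsContained G := by
  obtain ⟨C', hPC', hC'C, hC'⟩ := Finset.exists_subsuperset_card_eq
    (s := P.image g) (t := C) (n := Fintype.card W) (Finset.image_subset_iff.2 hgC)
    (Finset.card_image_le.trans (Finset.card_le_univ P)) hC
  obtain ⟨e, he⟩ := Finset.exists_equiv_extend_of_card_eq hC'.symm hPC' hg
  have e' : T ≃ S := Finset.equivOfCardEq hTS
  have hdisj : ∀ (s : S) (c : C'), s.1 ≠ c.1 := fun s c h =>
    (hSC s.1 s.2 c.1 (hC'C c.2)).ne h
  refine ⟨⟨⟨fun x => if h : x ∈ T then e' ⟨x, h⟩ else e x, ?_⟩, ?_⟩⟩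
  · intro a b hab
    by_cases ha : a ∈ T <;> by_cases hb : b ∈ T
    · exact absurd hab (hT a ha b hb)
    · simpa [ha, hb] using hSC _ (e' ⟨a, ha⟩).2 _ (hC'C (e b).2)
    · simpa [ha, hb] using (hSC _ (e' ⟨b, hb⟩).2 _ (hC'C (e a).2)).symm
    · obtain ⟨h1, h2, h3⟩ := hP a b hab ha hb
      simpa [ha, hb, he a h1, he b h2] using h3
  · intro a b hab
    by_cases ha : a ∈ T <;> by_cases hb : b ∈ T
    · simpa [ha, hb] using hab
    · simp only [RelHom.coeFn_mk, ha, hb, dite_true, dite_false] at hab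
      exact absurd hab (hdisj _ _)
    · simp only [RelHom.coeFn_mk, ha, hb, dite_true, dite_false] at hab
      exact absurd hab.symm (hdisj _ _)
    · simpa [ha, hb] using hab

/-- The smaller colour class of the bipartite graph `intersectingCycles (2 * k ·)`: the centre
together with the vertices at even distance from it along the cycles. -/
def evenClass {t : ℕ} (k : Fin t → ℕ) : Finset (Option (Σ i : Fin t, Fin (2 * k i - 1))) :=
  Finset.insertNone (Finset.univ.filter fun x => x.2.val % 2 = 1)

@[simp] lemma none_mem_evenClass {t : ℕ} {k : Fin t → ℕ} : none ∈ evenClass k := by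
  simp [evenClass]

@[simp] lemma some_mem_evenClass {t : ℕ} {k : Fin t → ℕ} {i : Fin t} {b : Fin (2 * k i - 1)} :
    some ⟨i, b⟩ ∈ evenClass k ↔ b.val % 2 = 1 := by
  simp [evenClass]

lemma card_evenClass {t : ℕ} (k : Fin t → ℕ) : (evenClass k).card = ∑ i, (k i - 1) + 1 := by
  rw [evenClass, Finset.card_insertNone]
  congr 1
  have : ∑ i, (k i - 1) = (Finset.univ : Finset (Σ i : Fin t, Fin (k i - 1))).card := by simp
  rw [this]
  symm
  refine Finset.card_nbij (fun x => ⟨x.1, ⟨2 * x.2.val + 1, by have := x.2.2; omega⟩⟩) ?_ ?_ ?_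
  · rintro ⟨i, b⟩ -
    simp
  · rintro ⟨i, a⟩ - ⟨j, b⟩ - h
    simp only [Sigma.mk.injEq] at h
    obtain ⟨rfl, h⟩ := h
    simp only [heq_eq_eq, Fin.mk.injEq] at h
    simp only [Sigma.mk.injEq, heq_eq_eq, true_and, Fin.ext_iff]
    omega
  · rintro ⟨i, b⟩ hb
    simp only [Finset.coe_filter, Finset.mem_univ, true_and, Set.mem_ofPred_eq] at hb
    refine ⟨⟨i, ⟨b.val / 2, by have := b.2; omega⟩⟩, by simp, ?_⟩
    simp only [Sigma.mk.injEq, heq_eq_eq, true_and, Fin.ext_iff]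
    omega

lemma card_vertices_intersectingCycles {t : ℕ} (l : Fin t → ℕ) :
    Fintype.card (Option (Σ i : Fin t, Fin (l i - 1))) = 1 + ∑ i, (l i - 1) := by
  simp [add_comm]

/-- A complete bipartite graph whose smaller side has `κ + 1` vertices contains the intersecting
cycles. -/
lemma intersectingCycles_isContained_of_completeBipartite {V : Type*} [DecidableEq V]
    {G : SimpleGraph V} {t : ℕ} {k : Fin t → ℕ} (hk : ∀ i, 2 ≤ k i) (S C : Finset V)
    (hS : S.card = ∑ i, (k i - 1) + 1) (hC : 1 + ∑ i, (2 * k i - 1) ≤ C.card)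
    (hSC : ∀ s ∈ S, ∀ c ∈ C, G.Adj s c) :
    (intersectingCycles fun i => 2 * k i).IsContained G := by
  rcases S.eq_empty_or_nonempty with rfl | ⟨s, -⟩
  · simp at hS
  refine isContained_of_join (evenClass k) ∅ S C (fun _ => s) (by rw [card_evenClass, hS]) ?_ hSC
    ?_ (by simp) (by simp) (by rwa [card_vertices_intersectingCycles])
  · intro a ha b hb hab
    revert ha hb
    refine intersectingCycles_adj_rec (P := fun a b => a ∈ evenClass k → b ∈ evenClass k → False)
      (fun _ _ h h1 h2 => h h2 h1) ?_ ?_ hab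
    · intro i b hb; have := hk i; simp; omega
    · intro i a b hab; simp; omega
  · intro a b hab ha hb
    exfalso
    revert ha hb
    refine intersectingCycles_adj_rec (P := fun a b => a ∉ evenClass k → b ∉ evenClass k → False)
      (fun _ _ h h1 h2 => h h2 h1) ?_ ?_ hab
    · intro i b hb; simp
    · intro i a b hab; simp; omega

/-- If `κ` vertices are completely joined to a large set `C`, then a path with two edges in `C`
yields the intersecting cycles: the middle vertex of the path replaces one vertex of the
smaller colour class. -/
lemma intersectingCycles_isContained_of_path {V : Type*} [DecidableEq V]
    {G : SimpleGraph V} {t : ℕ} {k : Fin t → ℕ} (hk : ∀ i, 2 ≤ k i) (i₀ : Fin t) (S C : Finset V)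
    (hS : S.card = ∑ i, (k i - 1)) (hC : 1 + ∑ i, (2 * k i - 1) ≤ C.card)
    (hSC : ∀ s ∈ S, ∀ c ∈ C, G.Adj s c) {u v w : V} (hu : u ∈ C) (hv : v ∈ C) (hw : w ∈ C)
    (huv : G.Adj u v) (hvw : G.Adj v w) (huw : u ≠ w) :
    (intersectingCycles fun i => 2 * k i).IsContained G := by
  have hk0 := hk i₀
  let y : Option (Σ i : Fin t, Fin (2 * k i - 1)) := some ⟨i₀, ⟨1, by omega⟩⟩
  have hy : ∀ (i : Fin t) (b : Fin (2 * k i - 1)), some ⟨i, b⟩ = y ↔ i = i₀ ∧ b.val = 1 := by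
    intro i b
    simp only [y, Option.some.injEq]
    constructor
    · intro h; cases h; simp
    · rintro ⟨rfl, h⟩; simp [Fin.ext_iff, h]
  have hy0 : none ≠ y := by simp [y]
  have hyT : y ∈ evenClass k := by simp [y]
  let P : Finset (Option (Σ i : Fin t, Fin (2 * k i - 1))) :=
    (Finset.univ.filter fun x => x.1 = i₀ ∧ x.2.val ≤ 2).image some
  let g : Option (Σ i : Fin t, Fin (2 * k i - 1)) → V := fun x => x.elim u fun x =>
    if x.2.val = 0 then u else if x.2.val = 1 then v else w
  have hPm : ∀ (i : Fin t) (b : Fin (2 * k i - 1)), some ⟨i, b⟩ ∈ P ↔ i = i₀ ∧ b.val ≤ 2 := by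
    simp [P]
  refine isContained_of_join ((evenClass k).erase y) P S C g
    (by rw [Finset.card_erase_of_mem hyT, card_evenClass, hS]; rfl) ?_ hSC ?_ ?_ ?_
    (by rwa [card_vertices_intersectingCycles])
  · intro a ha b hb hab
    replace ha := Finset.mem_of_mem_erase ha
    replace hb := Finset.mem_of_mem_erase hb
    revert ha hb
    refine intersectingCycles_adj_rec (P := fun a b => a ∈ evenClass k → b ∈ evenClass k → False)
      (fun _ _ h h1 h2 => h h2 h1) ?_ ?_ hab
    · intro i b hb; have := hk i; simp; omega
    · intro i a b hab; simp; omega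
  · intro a b hab
    refine intersectingCycles_adj_rec (P := fun a b => a ∉ (evenClass k).erase y →
      b ∉ (evenClass k).erase y → a ∈ P ∧ b ∈ P ∧ G.Adj (g a) (g b)) ?_ ?_ ?_ hab
    · intro a b h h1 h2
      obtain ⟨h3, h4, h5⟩ := h h2 h1
      exact ⟨h4, h3, h5.symm⟩
    · intro i b hb; simp [hy0]
    · intro i a b hab
      simp only [Finset.mem_erase, ne_eq, hy, some_mem_evenClass, hPm, g, Option.elim_some]
      intro h1 h2
      by_cases hi : i = i₀
      · simp only [hi, true_and, not_and] at h1 h2 ⊢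
        have : a.val = 0 ∨ a.val = 1 := by omega
        rcases this with h | h
        · have hb : b.val = 1 := by omega
          simpa [h, hb] using huv
        · have hb : b.val = 2 := by omega
          simpa [h, hb] using hvw
      · simp only [hi, false_and, not_false_eq_true, true_and] at h1 h2
        omega
  · intro a _
    simp only [g]
    rcases a with _ | a
    · exact hu
    · simp only [Option.elim_some]
      split_ifs <;> assumption
  · rintro (_ | ⟨i, a⟩) ha (_ | ⟨j, b⟩) hb hab
    · rfl
    · simp [P] at ha
    · simp [P] at hb
    · rw [Finset.mem_coe, hPm] at ha hb
      obtain ⟨rfl, ha⟩ := ha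
      obtain ⟨rfl, hb⟩ := hb
      simp only [Option.some.injEq, Sigma.mk.injEq, heq_eq_eq, true_and, Fin.ext_iff]
      simp only [g, Option.elim_some] at hab
      have := huv.ne
      have := hvw.ne
      split_ifs at hab <;> first | omega | exact absurd hab ‹_› | exact absurd hab.symm ‹_›

/-- If `κ` vertices are completely joined to a large set `C`, then two disjoint edges in `C` yield
the intersecting cycles, provided that one of the cycles has length at least six. On that cycle, the
two vertices at distances `2` and `4` from the centre are replaced by the vertex between
them, which leaves two disjoint edges uncovered. -/
lemma intersectingCycles_isContained_of_two_edges {V : Type*} [DecidableEq V]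
    {G : SimpleGraph V} {t : ℕ} {k : Fin t → ℕ} (hk : ∀ i, 2 ≤ k i) (i₀ : Fin t) (hi₀ : 3 ≤ k i₀)
    (S C : Finset V) (hS : S.card = ∑ i, (k i - 1)) (hC : 1 + ∑ i, (2 * k i - 1) ≤ C.card)
    (hSC : ∀ s ∈ S, ∀ c ∈ C, G.Adj s c) {u v w z : V} (hu : u ∈ C) (hv : v ∈ C) (hw : w ∈ C)
    (hz : z ∈ C) (huv : G.Adj u v) (hwz : G.Adj w z) (huw : u ≠ w) (huz : u ≠ z) (hvw : v ≠ w)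
    (hvz : v ≠ z) :
    (intersectingCycles fun i => 2 * k i).IsContained G := by
  have hm : ∀ j : ℕ, j < 5 → j < 2 * k i₀ - 1 := by omega
  let y : (j : ℕ) → j < 5 → Option (Σ i : Fin t, Fin (2 * k i - 1)) :=
    fun j hj => some ⟨i₀, ⟨j, hm j hj⟩⟩
  have hy : ∀ (i : Fin t) (b : Fin (2 * k i - 1)) (j : ℕ) (hj : j < 5),
      some ⟨i, b⟩ = y j hj ↔ i = i₀ ∧ b.val = j := by
    intro i b j hj
    simp only [y, Option.some.injEq]
    constructor
    · intro h; cases h; simp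
    · rintro ⟨rfl, h⟩; simp [Fin.ext_iff, h]
  have hy0 : ∀ j hj, none ≠ y j hj := by simp [y]
  have hyT : ∀ j hj, y j hj ∈ evenClass k ↔ j % 2 = 1 := by simp [y]
  have hyy : ∀ j hj j' hj', y j hj = y j' hj' ↔ j = j' := fun j hj j' hj' => by
    rw [show y j hj = some ⟨i₀, ⟨j, hm j hj⟩⟩ from rfl, hy _ _ _ hj']; simp
  let P : Finset (Option (Σ i : Fin t, Fin (2 * k i - 1))) :=
    (Finset.univ.filter fun x => x.1 = i₀ ∧ x.2.val ≤ 4 ∧ x.2.val ≠ 2).image some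
  let g : Option (Σ i : Fin t, Fin (2 * k i - 1)) → V := fun x => x.elim u fun x =>
    if x.2.val = 0 then u else if x.2.val = 1 then v else if x.2.val = 3 then w else z
  have hPm : ∀ (i : Fin t) (b : Fin (2 * k i - 1)),
      some ⟨i, b⟩ ∈ P ↔ i = i₀ ∧ b.val ≤ 4 ∧ b.val ≠ 2 := by
    simp [P]
  let T := insert (y 2 (by simp)) (((evenClass k).erase (y 1 (by simp))).erase (y 3 (by simp)))
  have hTm : ∀ (i : Fin t) (b : Fin (2 * k i - 1)), some ⟨i, b⟩ ∈ T ↔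
      (i = i₀ ∧ b.val = 2) ∨
        (¬(i = i₀ ∧ b.val = 3) ∧ ¬(i = i₀ ∧ b.val = 1) ∧ b.val % 2 = 1) := by
    simp [T, hy]
  have hTn : none ∈ T := by simp [T, hy0]
  have hTc : T.card = S.card := by
    have h1 : y 1 (by simp) ∈ evenClass k := by simp [hyT]
    have h3 : y 3 (by simp) ∈ (evenClass k).erase (y 1 (by simp)) := by simp [hyT, hyy]
    rw [Finset.card_insert_of_notMem (by simp [hyT, hyy]), Finset.card_erase_add_one h3,
      Finset.card_erase_of_mem h1, card_evenClass, hS]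
    rfl
  refine isContained_of_join T P S C g hTc ?_ hSC ?_ ?_ ?_
    (by rwa [card_vertices_intersectingCycles])
  · intro a ha b hb hab
    revert ha hb
    refine intersectingCycles_adj_rec (P := fun a b => a ∈ T → b ∈ T → False)
      (fun _ _ h h1 h2 => h h2 h1) ?_ ?_ hab
    · intro i b hb _
      have := hk i
      have hb : b.val = 0 ∨ b.val + 2 = 2 * k i := hb
      rw [hTm]
      rintro (⟨h', h⟩ | h)
      · subst h'; omega
      · omega
    · intro i a b hab
      rw [hTm, hTm]
      by_cases hi : i = i₀
      · simp only [hi, true_and]; omega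
      · simp only [hi, false_and, not_false_eq_true, true_and, false_or]; omega
  · intro a b hab
    refine intersectingCycles_adj_rec (P := fun a b => a ∉ T →
      b ∉ T → a ∈ P ∧ b ∈ P ∧ G.Adj (g a) (g b)) ?_ ?_ ?_ hab
    · intro a b h h1 h2
      obtain ⟨h3, h4, h5⟩ := h h2 h1
      exact ⟨h4, h3, h5.symm⟩
    · intro i b hb h; exact absurd hTn h
    · intro i a b hab
      rw [hTm, hTm, hPm, hPm]
      simp only [g, Option.elim_some]
      intro h1 h2
      by_cases hi : i = i₀
      · simp only [hi, true_and] at h1 h2 ⊢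
        have : a.val = 0 ∨ a.val = 3 := by omega
        rcases this with h | h
        · have hb : b.val = 1 := by omega
          simpa [h, hb] using huv
        · have hb : b.val = 4 := by omega
          simpa [h, hb] using hwz
      · simp only [hi, false_and, not_false_eq_true, true_and, false_or] at h1 h2
        omega
  · intro a _
    simp only [g]
    rcases a with _ | a
    · exact hu
    · simp only [Option.elim_some]
      split_ifs <;> assumption
  · rintro (_ | ⟨i, a⟩) ha (_ | ⟨j, b⟩) hb hab
    · rfl
    · simp [P] at ha
    · simp [P] at hb
    · rw [Finset.mem_coe, hPm] at ha hb
      obtain ⟨rfl, ha⟩ := ha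
      obtain ⟨rfl, hb⟩ := hb
      simp only [Option.some.injEq, Sigma.mk.injEq, heq_eq_eq, true_and, Fin.ext_iff]
      simp only [g, Option.elim_some] at hab
      have := huv.ne
      have := hwz.ne
      split_ifs at hab <;> first | omega | exact absurd hab ‹_› | exact absurd hab.symm ‹_›

/-! ### The graph `S⁺` contains no intersecting cycles -/

lemma splitGraph_adj {n κ : ℕ} {a b : Fin n} :
    (splitGraph n κ).Adj a b ↔ a ≠ b ∧ (a.val < κ ∨ b.val < κ) := by
  simp [splitGraph]

lemma splitGraphPlus_adj {n κ : ℕ} {a b : Fin n} :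
    (splitGraphPlus n κ).Adj a b ↔ a ≠ b ∧ (a.val < κ ∨ b.val < κ ∨
      (a.val = κ ∧ b.val = κ + 1) ∨ (b.val = κ ∧ a.val = κ + 1)) := by
  simp only [splitGraphPlus, SimpleGraph.sup_adj, splitGraph_adj, SimpleGraph.fromRel_adj]
  tauto

/-- After the removal of any one edge `xy` there is still a matching of size `κ + 1`. Indeed there
are two disjoint ones: take a perfect matching of the cycle number `i₀` and, in each other cycle
`i`, one of the two disjoint matchings with `k i - 1` edges of the path that avoids the centre. -/
lemma exists_matching_intersectingCycles {t : ℕ} {k : Fin t → ℕ} (hk : ∀ i, 2 ≤ k i) (i₀ : Fin t)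
    (x y : Option (Σ i : Fin t, Fin (2 * k i - 1))) :
    ∃ p q : Option (Σ i : Fin t, Fin (k i - 1)) → Option (Σ i : Fin t, Fin (2 * k i - 1)),
      (∀ j, (intersectingCycles fun i => 2 * k i).Adj (p j) (q j)) ∧
      Function.Injective (Sum.elim p q) ∧
      ∀ j, ¬(p j = x ∧ q j = y) ∧ ¬(p j = y ∧ q j = x) := by
  let p : Fin 2 → Option (Σ i : Fin t, Fin (k i - 1)) →
      Option (Σ i : Fin t, Fin (2 * k i - 1)) := fun s =>
    Option.map fun j => ⟨j.1, ⟨2 * j.2.val + s.val, by have := j.2.2; omega⟩⟩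
  let q : Fin 2 → Option (Σ i : Fin t, Fin (k i - 1)) →
      Option (Σ i : Fin t, Fin (2 * k i - 1)) := fun s j => some <| j.elim
    ⟨i₀, ⟨(2 * k i₀ - 2) * (1 - s.val), by
      have := hk i₀; have : s.val = 0 ∨ s.val = 1 := by omega
      rcases this with h | h <;> simp [h] <;> omega⟩⟩
    fun j => ⟨j.1, ⟨2 * j.2.val + s.val + 1, by have := j.2.2; omega⟩⟩
  have hsome : ∀ (i j : Fin t) (a : Fin (2 * k i - 1)) (b : Fin (2 * k j - 1)),
      some (⟨i, a⟩ : Σ i : Fin t, Fin (2 * k i - 1)) = some ⟨j, b⟩ ↔ i = j ∧ a.val = b.val := by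
    intro i j a b
    simp only [Option.some.injEq]
    constructor
    · intro h; cases h; simp
    · rintro ⟨rfl, h⟩; simp [Fin.ext_iff, h]
  have hsome' : ∀ (i j : Fin t) (a : Fin (k i - 1)) (b : Fin (k j - 1)),
      some (⟨i, a⟩ : Σ i : Fin t, Fin (k i - 1)) = some ⟨j, b⟩ ↔ i = j ∧ a.val = b.val := by
    intro i j a b
    simp only [Option.some.injEq]
    constructor
    · intro h; cases h; simp
    · rintro ⟨rfl, h⟩; simp [Fin.ext_iff, h]
  have hadj : ∀ s j, (intersectingCycles fun i => 2 * k i).Adj (p s j) (q s j) := by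
    rintro s (_ | ⟨j, b⟩)
    · refine intersectingCycles_adj_center _ _ ?_
      have := hk i₀
      simp only
      fin_cases s <;> simp
      omega
    · exact intersectingCycles_adj_succ _ _ _ rfl
  have hinj : ∀ s, Function.Injective (Sum.elim (p s) (q s)) := by
    intro s
    have hk0 := hk i₀
    refine Function.Injective.sumElim ?_ ?_ ?_
    · rintro (_ | ⟨j, a⟩) (_ | ⟨j', b⟩) h
      · rfl
      · simp [p] at h
      · simp [p] at h
      · simp only [p, Option.map_some, hsome] at h
        rw [hsome']
        omega
    · rintro (_ | ⟨j, a⟩) (_ | ⟨j', b⟩) h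
      · rfl
      · simp only [q, Option.elim_none, Option.elim_some, hsome] at h
        obtain ⟨rfl, h⟩ := h
        have := b.2
        fin_cases s <;> simp at h
        omega
      · simp only [q, Option.elim_none, Option.elim_some, hsome] at h
        obtain ⟨rfl, h⟩ := h
        have := a.2
        fin_cases s <;> simp at h
        omega
      · simp only [q, Option.elim_some, hsome] at h
        rw [hsome']
        omega
    · rintro (_ | ⟨j, a⟩) (_ | ⟨j', b⟩) h
      · simp [p, q] at h
      · simp [p, q] at h
      · simp only [p, q, Option.map_some, Option.elim_none, hsome] at h
        obtain ⟨rfl, h⟩ := h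
        have := a.2
        fin_cases s <;> simp at h
        omega
      · simp only [p, q, Option.map_some, Option.elim_some, hsome] at h
        omega
  have hdis : ∀ j j', ¬(p 0 j = p 1 j' ∧ q 0 j = q 1 j') ∧ ¬(p 0 j = q 1 j' ∧ q 0 j = p 1 j') := by
    have hk0 := hk i₀
    rintro (_ | ⟨i, a⟩) (_ | ⟨j, b⟩)
    all_goals
      simp only [p, q, Option.map_some, Option.map_none, Option.elim_none, Option.elim_some, hsome,
        reduceCtorEq, false_and, and_false, not_false_eq_true, true_and, and_true, and_self,
        Fin.val_zero, Fin.val_one, Nat.sub_zero, Nat.sub_self, mul_one, mul_zero]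
    all_goals omega
  by_contra! hcon
  obtain ⟨j, hj⟩ := hcon (p 0) (q 0) (hadj 0) (hinj 0)
  obtain ⟨j', hj'⟩ := hcon (p 1) (q 1) (hadj 1) (hinj 1)
  have h := hdis j j'
  by_cases h1 : p 0 j = x ∧ q 0 j = y <;> by_cases h2 : p 1 j' = x ∧ q 1 j' = y
  · exact h.1 ⟨h1.1.trans h2.1.symm, h1.2.trans h2.2.symm⟩
  · obtain ⟨h3, h4⟩ := hj' (fun e1 e2 => h2 ⟨e1, e2⟩)
    exact h.2 ⟨h1.1.trans h4.symm, h1.2.trans h3.symm⟩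
  · obtain ⟨h3, h4⟩ := hj (fun e1 e2 => h1 ⟨e1, e2⟩)
    exact h.2 ⟨h3.trans h2.2.symm, h4.trans h2.1.symm⟩
  · obtain ⟨h3, h4⟩ := hj (fun e1 e2 => h1 ⟨e1, e2⟩)
    obtain ⟨h5, h6⟩ := hj' (fun e1 e2 => h2 ⟨e1, e2⟩)
    exact h.1 ⟨h3.trans h5.symm, h4.trans h6.symm⟩

/-- Every edge of a matching in `S⁺`, except possibly the additional edge, uses one of the `κ`
vertices of the clique. -/
lemma card_le_of_matching {W I : Type*} [Fintype I] {A : SimpleGraph W} {n κ : ℕ}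
    (f : SimpleGraph.Copy A (splitGraphPlus n κ)) (p q : I → W) (hadj : ∀ j, A.Adj (p j) (q j))
    (hinj : Function.Injective (Sum.elim p q))
    (he : ∀ j, ¬((f (p j)).val = κ ∧ (f (q j)).val = κ + 1) ∧
      ¬((f (q j)).val = κ ∧ (f (p j)).val = κ + 1)) :
    Fintype.card I ≤ κ := by
  have h1 : ∀ j, (f (p j)).val < κ ∨ (f (q j)).val < κ := by
    intro j
    have := (splitGraphPlus_adj.1 (f.toHom.map_adj (hadj j))).2
    have := he j
    simp only [SimpleGraph.Copy.toHom_apply] at *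
    tauto
  let s : I → I ⊕ I := fun j => if (f (p j)).val < κ then Sum.inl j else Sum.inr j
  have hs : ∀ j, (f (Sum.elim p q (s j))).val < κ := by
    intro j
    simp only [s]
    split_ifs with h
    · exact h
    · exact (h1 j).resolve_left h
  have hsi : Function.Injective s := by
    intro i j h
    simp only [s] at h
    split_ifs at h <;> simpa using h
  have : Function.Injective fun j => (⟨_, hs j⟩ : Fin κ) := by
    intro i j h
    simp only [Fin.mk.injEq] at h
    exact hsi (hinj (f.injective (Fin.ext h)))
  simpa using Fintype.card_le_of_injective _ this

/-- `S⁺` contains no intersecting cycles. -/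
lemma splitGraphPlus_free {t : ℕ} {k : Fin t → ℕ} (hk : ∀ i, 2 ≤ k i) (i₀ : Fin t) (n : ℕ) :
    (intersectingCycles fun i => 2 * k i).Free (splitGraphPlus n (∑ i, (k i - 1))) := by
  rintro ⟨f⟩
  have key : ∃ p q : Option (Σ i : Fin t, Fin (k i - 1)) →
      Option (Σ i : Fin t, Fin (2 * k i - 1)),
      (∀ j, (intersectingCycles fun i => 2 * k i).Adj (p j) (q j)) ∧
      Function.Injective (Sum.elim p q) ∧
      ∀ j, ¬((f (p j)).val = ∑ i, (k i - 1) ∧ (f (q j)).val = ∑ i, (k i - 1) + 1) ∧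
        ¬((f (q j)).val = ∑ i, (k i - 1) ∧ (f (p j)).val = ∑ i, (k i - 1) + 1) := by
    by_cases hxy : ∃ x y, (f x).val = ∑ i, (k i - 1) ∧ (f y).val = ∑ i, (k i - 1) + 1
    · obtain ⟨x, y, hx, hy⟩ := hxy
      obtain ⟨p, q, h1, h2, h3⟩ := exists_matching_intersectingCycles hk i₀ x y
      have hf : ∀ a b, (f a).val = (f b).val → a = b := fun a b h => f.injective (Fin.ext h)
      refine ⟨p, q, h1, h2, fun j => ⟨fun h => (h3 j).1 ?_, fun h => (h3 j).2 ?_⟩⟩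
      · exact ⟨hf _ _ (h.1.trans hx.symm), hf _ _ (h.2.trans hy.symm)⟩
      · exact ⟨hf _ _ (h.2.trans hy.symm), hf _ _ (h.1.trans hx.symm)⟩
    · obtain ⟨p, q, h1, h2, -⟩ := exists_matching_intersectingCycles hk i₀ none none
      push Not at hxy
      exact ⟨p, q, h1, h2, fun j => ⟨fun h => hxy _ _ h.1 h.2, fun h => hxy _ _ h.1 h.2⟩⟩
  obtain ⟨p, q, h1, h2, h3⟩ := key
  have := card_le_of_matching f p q h1 h2 h3
  simp at this

/-! ### Spectral radius, quadratic form and Perron vector -/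

section Spectral

variable {V : Type*} [Fintype V] (G : SimpleGraph V) [DecidableRel G.Adj]

/-- The quadratic form `xᵀ A x` of the adjacency matrix `A` of `G`. -/
def adjForm (x : V → ℝ) : ℝ := ∑ v, x v * ∑ u ∈ G.neighborFinset v, x u

lemma adjForm_eq_dotProduct (x : V → ℝ) :
    adjForm G x = x ⬝ᵥ (G.adjMatrix ℝ).mulVec x := by
  simp [adjForm, dotProduct, SimpleGraph.adjMatrix_mulVec_apply]

lemma adjForm_smul (c : ℝ) (x : V → ℝ) : adjForm G (c • x) = c ^ 2 * adjForm G x := by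
  simp only [adjForm, Pi.smul_apply, smul_eq_mul, ← Finset.mul_sum]
  rw [Finset.mul_sum]
  exact Finset.sum_congr rfl fun _ _ => by ring

lemma abs_adjForm_le (x : V → ℝ) : |adjForm G x| ≤ adjForm G fun v => |x v| := by
  unfold adjForm
  refine (Finset.abs_sum_le_sum_abs _ _).trans (Finset.sum_le_sum fun v _ => ?_)
  rw [abs_mul]
  exact mul_le_mul_of_nonneg_left (Finset.abs_sum_le_sum_abs _ _) (abs_nonneg _)

/-- A vector at which the quadratic form attains its upper bound `μ * ∑ v, x v ^ 2` is an
eigenvector. -/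
lemma eigenvector_of_adjForm_eq {μ : ℝ} (hμ : ∀ y, adjForm G y ≤ μ * ∑ v, y v ^ 2) {x : V → ℝ}
    (hx : adjForm G x = μ * ∑ v, x v ^ 2) (v : V) :
    ∑ u ∈ G.neighborFinset v, x u = μ * x v := by
  classical
  let M : Matrix V V ℝ := μ • 1 - G.adjMatrix ℝ
  have hM : ∀ y, star y ⬝ᵥ M.mulVec y = μ * ∑ v, y v ^ 2 - adjForm G y := by
    intro y
    simp only [M, star_trivial, Matrix.sub_mulVec, Matrix.smul_mulVec, Matrix.one_mulVec,
      dotProduct_sub, adjForm_eq_dotProduct]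
    simp [dotProduct, Finset.mul_sum, pow_two, mul_left_comm]
  have hpsd : M.PosSemidef := by
    refine Matrix.PosSemidef.of_dotProduct_mulVec_nonneg ?_ fun y => ?_
    · have := SimpleGraph.isSymm_adjMatrix (α := ℝ) G
      rw [Matrix.IsHermitian, Matrix.conjTranspose_eq_transpose_of_trivial]
      simp [M, Matrix.transpose_sub]
    · rw [hM]; linarith [hμ y]
  have h0 := (hpsd.dotProduct_mulVec_zero_iff x).1 (by rw [hM, hx, sub_self])
  have := congrFun h0 v
  simp only [M, Matrix.sub_mulVec, Matrix.smul_mulVec, Matrix.one_mulVec, Pi.sub_apply,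
    Pi.smul_apply, smul_eq_mul, SimpleGraph.adjMatrix_mulVec_apply, Pi.zero_apply] at this
  linarith

/-- The quadratic form, restricted to the unit sphere, attains its maximum at a nonnegative
vector. -/
lemma exists_nonneg_maximizer [Nonempty V] :
    ∃ μ : ℝ, ∃ x : V → ℝ, (∀ v, 0 ≤ x v) ∧ ∑ v, x v ^ 2 = 1 ∧ adjForm G x = μ ∧
      ∀ y, adjForm G y ≤ μ * ∑ v, y v ^ 2 := by
  classical
  have hcont : Continuous (adjForm G) := by unfold adjForm; fun_prop
  have hcs : Continuous fun y : V → ℝ => ∑ v, y v ^ 2 := by fun_prop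
  have hcomp : IsCompact {y : V → ℝ | ∑ v, y v ^ 2 = 1} := by
    refine Metric.isCompact_of_isClosed_isBounded (isClosed_eq hcs continuous_const) ?_
    refine (Metric.isBounded_closedBall (x := (0 : V → ℝ)) (r := 1)).subset fun y hy => ?_
    rw [mem_closedBall_zero_iff, pi_norm_le_iff_of_nonneg zero_le_one]
    intro v
    have h1 : y v ^ 2 ≤ ∑ v, y v ^ 2 :=
      Finset.single_le_sum (f := fun v => y v ^ 2) (fun _ _ => sq_nonneg _) (Finset.mem_univ v)
    rw [show ∑ v, y v ^ 2 = 1 from hy] at h1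
    exact abs_le_one_iff_mul_self_le_one.2 (by rwa [← pow_two])
  obtain ⟨v₀⟩ := ‹Nonempty V›
  obtain ⟨y, hy, hmax⟩ := hcomp.exists_isMaxOn
    ⟨Pi.single v₀ 1, by simp [Pi.single_apply, ite_pow]⟩ hcont.continuousOn
  have hy1 : ∑ v, |y v| ^ 2 = 1 := by simpa using hy
  refine ⟨adjForm G fun v => |y v|, fun v => |y v|, fun v => abs_nonneg _, hy1, rfl, fun w => ?_⟩
  set s := ∑ v, w v ^ 2 with hs
  have hs0 : 0 ≤ s := Finset.sum_nonneg fun _ _ => sq_nonneg _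
  have hmax' : ∀ u : V → ℝ, ∑ v, u v ^ 2 = 1 → adjForm G u ≤ adjForm G fun v => |y v| :=
    fun u hu => (hmax hu).trans ((le_abs_self _).trans (abs_adjForm_le G y))
  rcases hs0.eq_or_lt with h0 | h0
  · have hw : w = 0 := by
      funext v
      have := (Finset.sum_eq_zero_iff_of_nonneg fun v _ => sq_nonneg (w v)).1 (hs ▸ h0.symm) v
        (Finset.mem_univ v)
      simpa using this
    simp [hw, adjForm, ← h0]
  · have h1 : (Real.sqrt s)⁻¹ ^ 2 = s⁻¹ := by rw [inv_pow, Real.sq_sqrt hs0]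
    have := hmax' ((Real.sqrt s)⁻¹ • w) (by
      simp only [Pi.smul_apply, smul_eq_mul, mul_pow, ← Finset.mul_sum, h1]
      exact inv_mul_cancel₀ h0.ne')
    rw [adjForm_smul, h1, inv_mul_le_iff₀ h0] at this
    linarith

end Spectral

lemma adjSpectralRadius_eq_ofReal {V : Type*} [Fintype V] (G : SimpleGraph V) [DecidableRel G.Adj]
    {μ : ℝ} {x : V → ℝ} (hx1 : ∑ v, x v ^ 2 = 1) (hxμ : adjForm G x = μ)
    (hμ : ∀ y, adjForm G y ≤ μ * ∑ v, y v ^ 2) :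
    adjSpectralRadius G = ENNReal.ofReal μ := by
  classical
  have hmem : ∀ c : ℝ, c ∈ spectrum ℝ (G.adjMatrix ℝ) ↔
      ∃ y : V → ℝ, y ≠ 0 ∧ ∀ v, ∑ u ∈ G.neighborFinset v, y u = c * y v := by
    intro c
    rw [← Matrix.spectrum_toLin', ← Module.End.hasEigenvalue_iff_mem_spectrum]
    constructor
    · intro h
      obtain ⟨y, hy⟩ := h.exists_hasEigenvector
      refine ⟨y, hy.2, fun v => ?_⟩
      have := congrFun hy.apply_eq_smul v
      simpa [SimpleGraph.adjMatrix_mulVec_apply] using this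
    · rintro ⟨y, hy0, hy⟩
      refine Module.End.hasEigenvalue_of_hasEigenvector (x := y)
        ⟨Module.End.mem_eigenspace_iff.2 ?_, hy0⟩
      funext v
      simpa [SimpleGraph.adjMatrix_mulVec_apply] using hy v
  have hrad : adjSpectralRadius G = spectralRadius ℝ (G.adjMatrix ℝ) := by
    unfold adjSpectralRadius
    congr!
  rw [hrad, spectralRadius]
  refine le_antisymm (iSup₂_le fun c hc => ?_) ?_
  · obtain ⟨y, hy0, hy⟩ := (hmem c).1 hc
    have hs : 0 < ∑ v, y v ^ 2 := by
      obtain ⟨v, hv⟩ := Function.ne_iff.1 hy0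
      exact Finset.sum_pos' (fun _ _ => sq_nonneg _) ⟨v, Finset.mem_univ v, sq_pos_of_ne_zero hv⟩
    have h1 : adjForm G y = c * ∑ v, y v ^ 2 := by
      rw [adjForm, Finset.mul_sum]
      exact Finset.sum_congr rfl fun v _ => by rw [hy]; ring
    have h2 := (abs_adjForm_le G y).trans (hμ _)
    simp only [sq_abs, h1, abs_mul, abs_of_pos hs] at h2
    have h3 := le_of_mul_le_mul_right h2 hs
    rw [← enorm_eq_nnnorm, ← ofReal_norm]
    exact ENNReal.ofReal_le_ofReal h3
  · have hμ0 : 0 ≤ μ := by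
      have h2 := (abs_nonneg _).trans ((abs_adjForm_le G x).trans (hμ _))
      simpa [hx1] using h2
    have hm : μ ∈ spectrum ℝ (G.adjMatrix ℝ) := by
      refine (hmem μ).2 ⟨x, ?_, eigenvector_of_adjForm_eq G hμ (by rw [hxμ, hx1, mul_one])⟩
      rintro rfl
      simp at hx1
    refine le_trans (le_of_eq ?_) (le_iSup₂ (f := fun k (_ : k ∈ spectrum ℝ (G.adjMatrix ℝ)) =>
      (‖k‖₊ : ℝ≥0∞)) μ hm)
    rw [← enorm_eq_nnnorm, ← ofReal_norm, Real.norm_of_nonneg hμ0]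

/-- The spectral radius as a real number. -/
noncomputable def graphIndex {V : Type*} [Fintype V] (G : SimpleGraph V) : ℝ :=
  (adjSpectralRadius G).toReal

lemma graphIndex_nonneg {V : Type*} [Fintype V] (G : SimpleGraph V) : 0 ≤ graphIndex G :=
  ENNReal.toReal_nonneg

section Index

variable {V : Type*} [Fintype V] [Nonempty V] (G : SimpleGraph V) [DecidableRel G.Adj]

lemma exists_nonneg_maximizer_graphIndex :
    ∃ x : V → ℝ, (∀ v, 0 ≤ x v) ∧ ∑ v, x v ^ 2 = 1 ∧ adjForm G x = graphIndex G ∧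
      adjSpectralRadius G = ENNReal.ofReal (graphIndex G) ∧
      ∀ y, adjForm G y ≤ graphIndex G * ∑ v, y v ^ 2 := by
  obtain ⟨μ, x, hx0, hx1, hxμ, hμ⟩ := exists_nonneg_maximizer G
  have h := adjSpectralRadius_eq_ofReal G hx1 hxμ hμ
  have hμ0 : 0 ≤ μ := hxμ ▸ Finset.sum_nonneg fun v _ =>
    mul_nonneg (hx0 v) (Finset.sum_nonneg fun u _ => hx0 u)
  have hμ' : graphIndex G = μ := by rw [graphIndex, h, ENNReal.toReal_ofReal hμ0]
  rw [hμ']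
  exact ⟨x, hx0, hx1, hxμ, h, hμ⟩

lemma adjForm_le_graphIndex (y : V → ℝ) : adjForm G y ≤ graphIndex G * ∑ v, y v ^ 2 :=
  let ⟨_, _, _, _, _, h⟩ := exists_nonneg_maximizer_graphIndex G
  h y

/-- A nonnegative eigenvector for the spectral radius, scaled so that its largest entry is `1`. -/
lemma exists_perron : ∃ x : V → ℝ, (∀ v, 0 ≤ x v) ∧ (∀ v, x v ≤ 1) ∧ (∃ z, x z = 1) ∧
    ∀ v, ∑ u ∈ G.neighborFinset v, x u = graphIndex G * x v := by
  obtain ⟨x, hx0, hx1, hx, -, h⟩ := exists_nonneg_maximizer_graphIndex G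
  have heig := eigenvector_of_adjForm_eq G h (by rw [hx, hx1, mul_one])
  obtain ⟨z, -, hz⟩ := Finset.exists_max_image Finset.univ x Finset.univ_nonempty
  have hz0 : 0 < x z := by
    refine (hx0 z).lt_of_ne fun e => ?_
    have : ∀ v, x v = 0 := fun v => le_antisymm (e ▸ hz v (Finset.mem_univ v)) (hx0 v)
    simp [this] at hx1
  refine ⟨fun v => x v / x z, fun v => div_nonneg (hx0 v) hz0.le, fun v =>
    (div_le_one hz0).2 (hz v (Finset.mem_univ v)), ⟨z, div_self hz0.ne'⟩, fun v => ?_⟩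
  simp only
  rw [← Finset.sum_div, heig, mul_div_assoc]

variable {G} in
lemma le_graphIndex {μ : ℝ} {x : V → ℝ} (hx : 0 < ∑ v, x v ^ 2)
    (h : μ * ∑ v, x v ^ 2 ≤ adjForm G x) : μ ≤ graphIndex G :=
  le_of_mul_le_mul_right (h.trans (adjForm_le_graphIndex G x)) hx

variable {G} in
/-- If the Rayleigh quotient of `x` is at least `μ` but `x` is not an eigenvector for `μ`, then the
spectral radius exceeds `μ`. -/
lemma lt_graphIndex {μ : ℝ} {x : V → ℝ} (hx : 0 < ∑ v, x v ^ 2)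
    (h : μ * ∑ v, x v ^ 2 ≤ adjForm G x) {v : V}
    (hv : ∑ u ∈ G.neighborFinset v, x u ≠ μ * x v) : μ < graphIndex G := by
  refine (le_graphIndex hx h).lt_of_ne ?_
  rintro rfl
  exact hv (eigenvector_of_adjForm_eq G (adjForm_le_graphIndex G)
    (le_antisymm (adjForm_le_graphIndex G x) h) v)

end Index

lemma graphIndex_le_of_iso {V W : Type*} [Fintype V] [Fintype W] [Nonempty V] {G : SimpleGraph V}
    {H : SimpleGraph W} (e : G ≃g H) : graphIndex G ≤ graphIndex H := by
  classical
  have : Nonempty W := ⟨e (Classical.arbitrary V)⟩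
  obtain ⟨x, -, hx1, hx, -⟩ := exists_nonneg_maximizer_graphIndex G
  have hs : ∑ w, x (e.symm w) ^ 2 = ∑ v, x v ^ 2 :=
    Equiv.sum_comp e.symm.toEquiv fun v => x v ^ 2
  refine le_graphIndex (x := fun w => x (e.symm w)) (by rw [hs, hx1]; exact one_pos) ?_
  rw [hs, hx1, mul_one, ← hx]
  refine le_of_eq ?_
  rw [adjForm, adjForm, ← Equiv.sum_comp e.symm.toEquiv]
  refine Finset.sum_congr rfl fun w _ => congrArg₂ _ rfl ?_
  refine Finset.sum_equiv e.toEquiv ?_ ?_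
  · intro u
    simp [← e.symm.map_adj_iff]
  · intro u _
    simp

lemma adjSpectralRadius_eq_of_iso {V W : Type*} [Fintype V] [Fintype W] [Nonempty V]
    {G : SimpleGraph V} {H : SimpleGraph W} (e : G ≃g H) :
    adjSpectralRadius G = adjSpectralRadius H := by
  classical
  have : Nonempty W := ⟨e (Classical.arbitrary V)⟩
  obtain ⟨-, -, -, -, h1, -⟩ := exists_nonneg_maximizer_graphIndex G
  obtain ⟨-, -, -, -, h2, -⟩ := exists_nonneg_maximizer_graphIndex H
  rw [h1, h2, le_antisymm (graphIndex_le_of_iso e) (graphIndex_le_of_iso e.symm)]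

lemma adjSpectralRadius_le_iff {V W : Type*} [Fintype V] [Fintype W] [Nonempty V] [Nonempty W]
    {G : SimpleGraph V} {H : SimpleGraph W} :
    adjSpectralRadius G ≤ adjSpectralRadius H ↔ graphIndex G ≤ graphIndex H := by
  classical
  obtain ⟨-, -, -, -, h1, -⟩ := exists_nonneg_maximizer_graphIndex G
  obtain ⟨-, -, -, -, h2, -⟩ := exists_nonneg_maximizer_graphIndex H
  rw [h1, h2, ENNReal.ofReal_le_ofReal_iff (graphIndex_nonneg H)]

/-- The complete bipartite graph inside `S⁺` shows that its spectral radius is at least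
`√(κ (n - κ))`. -/
lemma le_sq_graphIndex_splitGraphPlus {n κ : ℕ} (hκ : 0 < κ) (hn : κ < n) :
    (κ : ℝ) * (n - κ) ≤ graphIndex (splitGraphPlus n κ) ^ 2 := by
  classical
  have : Nonempty (Fin n) := ⟨⟨0, by omega⟩⟩
  have hnκ : (0 : ℝ) < n - κ := by rw [sub_pos]; exact_mod_cast hn
  have hκ0 : (0 : ℝ) < κ := by exact_mod_cast hκ
  set a := Real.sqrt (n - κ) with ha
  set b := Real.sqrt κ with hb
  have ha2 : a ^ 2 = n - κ := Real.sq_sqrt hnκ.le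
  have hb2 : b ^ 2 = κ := Real.sq_sqrt hκ0.le
  have ha0 : 0 < a := Real.sqrt_pos.2 hnκ
  have hb0 : 0 < b := Real.sqrt_pos.2 hκ0
  let S : Finset (Fin n) := Finset.univ.filter fun v => v.val < κ
  have hS : (S.card : ℝ) = κ := by
    have : S.card = κ := by
      rw [Fin.card_filter_val_lt]; omega
    exact_mod_cast this
  have hSc : (Sᶜ.card : ℝ) = n - κ := by
    rw [Finset.card_compl, Nat.cast_sub (Finset.card_le_univ S), hS, Fintype.card_fin]
  let x : Fin n → ℝ := fun v => if v ∈ S then a else b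
  have hx0 : ∀ v, 0 ≤ x v := fun v => by simp only [x]; split_ifs <;> positivity
  have hsum : ∀ f : Fin n → ℝ, ∑ v, f v = ∑ v ∈ S, f v + ∑ v ∈ Sᶜ, f v := fun f =>
    (Finset.sum_add_sum_compl S f).symm
  have hxS : ∀ v ∈ S, x v = a := fun v hv => by simp [x, hv]
  have hxSc : ∀ v ∈ Sᶜ, x v = b := fun v hv => by simp [x, Finset.mem_compl.1 hv]
  have hsq : ∑ v, x v ^ 2 = 2 * (κ * (n - κ)) := by
    rw [hsum, Finset.sum_congr rfl fun v hv => by rw [hxS v hv],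
      Finset.sum_congr (s₁ := Sᶜ) rfl fun v hv => by rw [hxSc v hv]]
    simp only [Finset.sum_const, nsmul_eq_mul, hS, hSc, ha2, hb2]
    ring
  have hN : ∀ v (T : Finset (Fin n)), (∀ u ∈ T, (splitGraphPlus n κ).Adj v u) →
      ∑ u ∈ T, x u ≤ ∑ u ∈ (splitGraphPlus n κ).neighborFinset v, x u := fun v T hT =>
    Finset.sum_le_sum_of_subset_of_nonneg (fun u hu => by simpa using hT u hu)
      fun u _ _ => hx0 u
  have hform : b * a * ∑ v, x v ^ 2 ≤ adjForm (splitGraphPlus n κ) x := by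
    have h1 : ∀ v ∈ S, a * ((n - κ) * b) ≤
        x v * ∑ u ∈ (splitGraphPlus n κ).neighborFinset v, x u := by
      intro v hv
      rw [hxS v hv]
      refine mul_le_mul_of_nonneg_left (le_trans (le_of_eq ?_) (hN v Sᶜ fun u hu => ?_)) ha0.le
      · rw [Finset.sum_congr rfl hxSc, Finset.sum_const, nsmul_eq_mul, hSc]
      · simp only [S, Finset.mem_compl, Finset.mem_filter, Finset.mem_univ, true_and] at hu hv
        exact splitGraphPlus_adj.2 ⟨fun e => hu (e ▸ hv), Or.inl hv⟩
    have h2 : ∀ v ∈ Sᶜ, b * (κ * a) ≤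
        x v * ∑ u ∈ (splitGraphPlus n κ).neighborFinset v, x u := by
      intro v hv
      rw [hxSc v hv]
      refine mul_le_mul_of_nonneg_left (le_trans (le_of_eq ?_) (hN v S fun u hu => ?_)) hb0.le
      · rw [Finset.sum_congr rfl hxS, Finset.sum_const, nsmul_eq_mul, hS]
      · simp only [S, Finset.mem_compl, Finset.mem_filter, Finset.mem_univ, true_and] at hu hv
        exact splitGraphPlus_adj.2 ⟨fun e => hv (e ▸ hu), Or.inr (Or.inl hu)⟩
    rw [hsq, adjForm, hsum]
    refine le_trans (le_of_eq ?_) (add_le_add (Finset.card_nsmul_le_sum _ _ _ h1)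
      (Finset.card_nsmul_le_sum _ _ _ h2))
    simp only [nsmul_eq_mul, hS, hSc]
    ring
  have := le_graphIndex (by rw [hsq]; positivity) hform
  calc (κ : ℝ) * (n - κ) = (b * a) ^ 2 := by rw [mul_pow, ha2, hb2]
    _ ≤ _ := pow_le_pow_left₀ (by positivity) this 2

/-! ### Locally sparse graphs and their Perron vectors -/

/-- The number of edges between a set of neighbours of a vertex and any other set of vertices is at
most `c` times the number of vertices involved. -/
def LocallySparse {V : Type*} (G : SimpleGraph V) [DecidableRel G.Adj] (c : ℕ) : Prop :=
  ∀ (v : V) (U W : Finset V), (∀ u ∈ U, G.Adj v u) →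
    ∑ u ∈ U, (W.filter (G.Adj u)).card ≤ c * (U.card + W.card)

/-- `x` is a nonnegative eigenvector of `G` with largest entry `1`, for an eigenvalue `μ` with
`μ ^ 2 ≥ κ (n - κ)`. -/
structure IsPerron {V : Type*} [Fintype V] (G : SimpleGraph V) [DecidableRel G.Adj] (κ : ℕ)
    (μ : ℝ) (x : V → ℝ) : Prop where
  nonneg : ∀ v, 0 ≤ x v
  le_one : ∀ v, x v ≤ 1
  exists_eq_one : ∃ z, x z = 1
  eig : ∀ v, ∑ u ∈ G.neighborFinset v, x u = μ * x v
  index_nonneg : 0 ≤ μ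
  le_sq : (κ : ℝ) * (Fintype.card V - κ) ≤ μ ^ 2

/-- The number of common neighbours of `v` and `w`; for `v = w` this is the degree. -/
def codeg {V : Type*} [Fintype V] (G : SimpleGraph V) [DecidableRel G.Adj] (v w : V) : ℕ :=
  ((G.neighborFinset v).filter (G.Adj · w)).card

section Basic

variable {V : Type*} [Fintype V] {G : SimpleGraph V} [DecidableRel G.Adj] {c κ : ℕ}
  {μ : ℝ} {x : V → ℝ}

lemma codeg_self (v : V) : codeg G v v = G.degree v := by
  rw [codeg, Finset.filter_true_of_mem, SimpleGraph.card_neighborFinset_eq_degree]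
  intro u hu
  exact ((G.mem_neighborFinset v u).1 hu).symm

lemma codeg_le_card (v w : V) : codeg G v w ≤ Fintype.card V := Finset.card_le_univ _

lemma sum_codeg (v : V) (W : Finset V) :
    ∑ w ∈ W, codeg G v w = ∑ u ∈ G.neighborFinset v, (W.filter (G.Adj u)).card :=
  (Finset.sum_card_bipartiteAbove_eq_sum_card_bipartiteBelow G.Adj).symm

lemma degree_le_card (v : V) : G.degree v ≤ Fintype.card V := Finset.card_le_univ _

lemma LocallySparse.sum_codeg_le (hG : LocallySparse G c) (v : V) (W : Finset V) :
    (∑ w ∈ W, (codeg G v w : ℝ)) ≤ c * (G.degree v + W.card) := by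
  rw [← Nat.cast_sum, sum_codeg]
  exact_mod_cast hG v _ W fun u hu => (G.mem_neighborFinset v u).1 hu

lemma LocallySparse.sum_codeg_univ_le (hG : LocallySparse G c) (v : V) :
    (∑ w, (codeg G v w : ℝ)) ≤ 2 * c * Fintype.card V := by
  refine (hG.sum_codeg_le v Finset.univ).trans ?_
  have : (G.degree v : ℝ) ≤ Fintype.card V := by exact_mod_cast degree_le_card v
  rw [Finset.card_univ]
  nlinarith [(Nat.cast_nonneg c : (0 : ℝ) ≤ c)]

lemma LocallySparse.sum_degree_le (hG : LocallySparse G c) (v : V) :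
    (∑ u ∈ G.neighborFinset v, (G.degree u : ℝ)) ≤ 2 * c * Fintype.card V := by
  refine le_trans (le_of_eq ?_) (hG.sum_codeg_univ_le v)
  rw [← Nat.cast_sum, ← Nat.cast_sum, sum_codeg]
  simp only [← SimpleGraph.card_neighborFinset_eq_degree, SimpleGraph.neighborFinset_eq_filter]

/-- Counting walks of length two: only boundedly many vertices have linear degree. -/
lemma LocallySparse.card_high_degree_le [Nonempty V] (hG : LocallySparse G c) {ε : ℝ} (hε : 0 < ε) :
    ((Finset.univ.filter fun v => ε * Fintype.card V ≤ G.degree v).card : ℝ) ≤ 2 * c / ε ^ 2 := by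
  set n : ℝ := (Fintype.card V : ℝ) with hn
  have hn0 : 0 < n := by rw [hn]; exact_mod_cast Fintype.card_pos
  have h1 : ∑ v, (G.degree v : ℝ) ^ 2 ≤ n * (2 * c * n) := by
    calc ∑ v, (G.degree v : ℝ) ^ 2
        = ∑ v, ∑ u, if G.Adj v u then (G.degree v : ℝ) else 0 := by
          refine Finset.sum_congr rfl fun v _ => ?_
          rw [← Finset.sum_filter, Finset.sum_const, nsmul_eq_mul, pow_two,
            ← SimpleGraph.neighborFinset_eq_filter, SimpleGraph.card_neighborFinset_eq_degree]
      _ = ∑ u, ∑ v ∈ G.neighborFinset u, (G.degree v : ℝ) := by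
          rw [Finset.sum_comm]
          refine Finset.sum_congr rfl fun u _ => ?_
          rw [← Finset.sum_filter, SimpleGraph.neighborFinset_eq_filter]
          simp only [G.adj_comm]
      _ ≤ ∑ u : V, 2 * c * n := Finset.sum_le_sum fun u _ => hG.sum_degree_le u
      _ = n * (2 * c * n) := by rw [Finset.sum_const, nsmul_eq_mul, Finset.card_univ]
  have h2 : ((Finset.univ.filter fun v => ε * n ≤ G.degree v).card : ℝ) * (ε * n) ^ 2 ≤
      ∑ v, (G.degree v : ℝ) ^ 2 := by
    rw [← nsmul_eq_mul]
    refine (Finset.card_nsmul_le_sum _ (fun v => (G.degree v : ℝ) ^ 2) _ fun v hv => ?_).trans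
      (Finset.sum_le_sum_of_subset_of_nonneg (Finset.subset_univ _) fun _ _ _ => sq_nonneg _)
    exact pow_le_pow_left₀ (by positivity) (Finset.mem_filter.1 hv).2 2
  rw [le_div_iff₀ (by positivity)]
  have h3 := h2.trans h1
  have h4 : 0 < n ^ 2 := by positivity
  refine le_of_mul_le_mul_right ?_ h4
  linarith

lemma IsPerron.mul_le_degree (hx : IsPerron G κ μ x) (v : V) : μ * x v ≤ G.degree v := by
  rw [← hx.eig, ← SimpleGraph.card_neighborFinset_eq_degree, ← nsmul_one, ← Finset.sum_const]
  exact Finset.sum_le_sum fun u _ => hx.le_one u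

/-- Counting walks of length two with weights. -/
lemma IsPerron.sq_mul (hx : IsPerron G κ μ x) (v : V) :
    μ ^ 2 * x v = ∑ w, (codeg G v w : ℝ) * x w := by
  calc μ ^ 2 * x v = ∑ u ∈ G.neighborFinset v, μ * x u := by
        rw [← Finset.mul_sum, hx.eig]; ring
    _ = ∑ u ∈ G.neighborFinset v, ∑ w, if G.Adj u w then x w else 0 := by
        refine Finset.sum_congr rfl fun u _ => ?_
        rw [← hx.eig, SimpleGraph.neighborFinset_eq_filter, Finset.sum_filter]
    _ = _ := by
        rw [Finset.sum_comm]
        refine Finset.sum_congr rfl fun w _ => ?_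
        rw [← Finset.sum_filter, Finset.sum_const, nsmul_eq_mul, codeg]

/-- Vertices of weight at least `α` have degree at least `μ α`, so no vertex has many neighbours
among them. -/
lemma LocallySparse.card_heavy_neighbors_le (hG : LocallySparse G c) (hx : IsPerron G κ μ x)
    (u : V) {α : ℝ} :
    (((G.neighborFinset u).filter fun w => α ≤ x w).card : ℝ) * (μ * α) ≤
      2 * c * Fintype.card V := by
  refine le_trans ?_ (hG.sum_degree_le u)
  rw [← nsmul_eq_mul]
  refine (Finset.card_nsmul_le_sum _ (fun v => (G.degree v : ℝ)) _ fun v hv => ?_).trans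
    (Finset.sum_le_sum_of_subset_of_nonneg (Finset.filter_subset _ _) fun _ _ _ => Nat.cast_nonneg _)
  exact (mul_le_mul_of_nonneg_left (Finset.mem_filter.1 hv).2 hx.index_nonneg).trans
    (hx.mul_le_degree v)

lemma IsPerron.le_index (hx : IsPerron G κ μ x) (hκ : 1 ≤ κ) {Λ : ℝ}
    (h : κ + Λ ^ 2 ≤ Fintype.card V) : Λ ≤ μ := by
  have h1 := hx.le_sq
  have h2 : (1 : ℝ) ≤ κ := by exact_mod_cast hκ
  refine le_of_sq_le_sq ?_ hx.index_nonneg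
  nlinarith [sq_nonneg Λ]

end Basic

/-- In a graph without intersecting cycles only few vertices `w` of weight at least `α` outside the
closed neighbourhood of `v` have two common neighbours with `v`. Otherwise, since these vertices
have unbounded degree, there are long alternating paths between them and vertices that are not
adjacent to `v`; together with two common neighbours such a path is an ear at `v`. -/
lemma card_heavy_codeg_lt {t : ℕ} {k : Fin t → ℕ} (hk : ∀ i, 2 ≤ k i) {κ : ℕ} (hκ : 1 ≤ κ)
    {α δ : ℝ} (hα : 0 < α) (hδ : 0 < δ) :
    ∃ N : ℕ, ∀ n, N ≤ n → ∀ (G : SimpleGraph (Fin n)) [DecidableRel G.Adj],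
      (intersectingCycles fun i => 2 * k i).Free G → ∀ (μ : ℝ) (x : Fin n → ℝ), IsPerron G κ μ x →
      ∀ v, ((Finset.univ.filter fun w => α ≤ x w ∧ w ≠ v ∧ ¬G.Adj v w ∧ 2 ≤ codeg G v w).card : ℝ) <
        δ * n := by
  set M : ℕ := 1 + ∑ i, (2 * k i - 1) with hM
  set c : ℕ := 2 * M with hc
  set Λ : ℝ := (8 * c * M / δ + M + 2 * c + 4 * c / δ + 1) / α with hΛ
  obtain ⟨N, hN⟩ := exists_nat_ge (κ + Λ ^ 2 + 4 * M / δ + 1)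
  refine ⟨N, fun n hn G _ hG μ x hx v => ?_⟩
  have hsp : LocallySparse G c := sum_card_filter_adj_le hk hG
  have hnN : (N : ℝ) ≤ n := by exact_mod_cast hn
  have hMδ : 0 ≤ 4 * M / δ := by positivity
  have hn1 : (1 : ℝ) ≤ n := by nlinarith [sq_nonneg Λ, (Nat.cast_nonneg κ : (0 : ℝ) ≤ κ)]
  have hμ : Λ ≤ μ := hx.le_index hκ (by rw [Fintype.card_fin]; linarith)
  have hμα : 8 * c * M / δ + M + 2 * c + 4 * c / δ + 1 ≤ μ * α := by
    rw [hΛ, div_le_iff₀ hα] at hμ; exact hμ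
  have hMn : M ≤ δ * n / 4 := by
    have : 4 * M / δ ≤ n := by nlinarith [sq_nonneg Λ, (Nat.cast_nonneg κ : (0 : ℝ) ≤ κ)]
    rw [div_le_iff₀ hδ] at this
    linarith
  have hcMδ : (0 : ℝ) ≤ 8 * c * M / δ := by positivity
  have hcδ : (0 : ℝ) ≤ 4 * c / δ := by positivity
  have hM0 : (0 : ℝ) ≤ M := Nat.cast_nonneg M
  have hc0 : (0 : ℝ) ≤ c := Nat.cast_nonneg c
  by_contra! hB
  set B := Finset.univ.filter fun w => α ≤ x w ∧ w ≠ v ∧ ¬G.Adj v w ∧ 2 ≤ codeg G v w with hBdef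
  refine hG (intersectingCycles_isContained_of_ears v fun X hvX hX i => ?_)
  have hXM : (X.card : ℝ) ≤ M := by exact_mod_cast hX
  -- `Z` consists of the heavy neighbours of `X`; it is small.
  set Z := X.biUnion fun u => (G.neighborFinset u).filter fun w => α ≤ x w with hZ
  have hZc : (Z.card : ℝ) ≤ δ * n / 4 := by
    have h1 : (Z.card : ℝ) * (μ * α) ≤ M * (2 * c * n) := by
      calc (Z.card : ℝ) * (μ * α)
          ≤ (∑ u ∈ X, (((G.neighborFinset u).filter fun w => α ≤ x w).card : ℝ)) * (μ * α) := by
            refine mul_le_mul_of_nonneg_right ?_ (by linarith)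
            exact_mod_cast Finset.card_biUnion_le
        _ ≤ ∑ u ∈ X, 2 * c * (n : ℝ) := by
            rw [Finset.sum_mul]
            refine Finset.sum_le_sum fun u _ => ?_
            simpa using hsp.card_heavy_neighbors_le hx u (α := α)
        _ = X.card * (2 * c * n) := by rw [Finset.sum_const, nsmul_eq_mul]
        _ ≤ _ := mul_le_mul_of_nonneg_right hXM (by positivity)
    have h2 : (8 * c * M / δ + 1) * Z.card ≤ M * (2 * c * n) := by
      nlinarith [(Nat.cast_nonneg Z.card : (0 : ℝ) ≤ Z.card)]
    have h3 : (8 * c * M / δ + 1) * (δ * n / 4) = 2 * c * M * n + δ * n / 4 := by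
      field_simp
      ring
    by_contra! h4
    have h5 := mul_lt_mul_of_pos_left h4 (show (0 : ℝ) < 8 * c * M / δ + 1 by linarith)
    have h6 : 0 < δ * n / 4 := by positivity
    linarith
  set W := B \ (X ∪ Z) with hW
  have hWc : δ * n / 2 ≤ W.card := by
    have h1 : B.card ≤ W.card + (X.card + Z.card) := by
      have : B.card - (X ∪ Z).card ≤ W.card := Finset.le_card_sdiff _ _
      have := Finset.card_union_le X Z
      omega
    have h2 : (B.card : ℝ) ≤ W.card + (X.card + Z.card) := by exact_mod_cast h1
    linarith
  set Y := Finset.univ \ (G.neighborFinset v ∪ X) with hY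
  have hdeg : c * (W.card + Y.card) < ∑ w ∈ W, (Y.filter (G.Adj w)).card := by
    have h1 : ∀ w ∈ W, μ * α - M - codeg G v w ≤ (Y.filter (G.Adj w)).card := by
      intro w hw
      have hwB := (Finset.mem_filter.1 (Finset.mem_sdiff.1 hw).1).2
      have h2 : G.neighborFinset w ⊆
          Y.filter (G.Adj w) ∪ ((G.neighborFinset v).filter (G.Adj · w) ∪ X) := by
        intro u hu
        have hu := (G.mem_neighborFinset w u).1 hu
        simp only [hY, Finset.mem_union, Finset.mem_filter, Finset.mem_sdiff, Finset.mem_univ,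
          true_and, hu, hu.symm, and_true]
        tauto
      have h3 := (Finset.card_le_card h2).trans ((Finset.card_union_le _ _).trans
        (Nat.add_le_add_left (Finset.card_union_le _ _) _))
      rw [SimpleGraph.card_neighborFinset_eq_degree] at h3
      have h4 : (G.degree w : ℝ) ≤ (Y.filter (G.Adj w)).card + (codeg G v w + X.card) := by
        exact_mod_cast h3
      have h5 := hx.mul_le_degree w
      have h6 := mul_le_mul_of_nonneg_left hwB.1 hx.index_nonneg
      linarith
    have h2 := Finset.sum_le_sum h1
    rw [Finset.sum_sub_distrib, Finset.sum_const, nsmul_eq_mul] at h2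
    have h3 := hsp.sum_codeg_le v W
    have h4 : (G.degree v : ℝ) ≤ n := by
      exact_mod_cast (degree_le_card v).trans (Fintype.card_fin n).le
    have h5 : (Y.card : ℝ) ≤ n := by
      exact_mod_cast (Finset.card_le_univ Y).trans (Fintype.card_fin n).le
    have h6 : (c : ℝ) * (W.card + Y.card) < ∑ w ∈ W, ((Y.filter (G.Adj w)).card : ℝ) := by
      have h7 : δ * n / 2 * (4 * c / δ + 1) ≤ W.card * (μ * α - M - 2 * c) := by
        refine mul_le_mul hWc (by linarith) (by positivity) (by positivity)
      have h8 : δ * n / 2 * (4 * c / δ + 1) = 2 * c * n + δ * n / 2 := by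
        field_simp
        ring
      have h9 : 0 < δ * n / 2 := by positivity
      have h10 : (c : ℝ) * (G.degree v + W.card) ≤ c * (n + W.card) := by gcongr
      have h11 : (c : ℝ) * (W.card + Y.card) ≤ c * (W.card + n) := by gcongr
      linarith
    exact_mod_cast h6
  obtain ⟨U', hU', W', hW', hne, h1, h2⟩ := exists_core G.Adj c W Y hdeg
  have hki := hk i
  have hiM : 2 * k i - 1 ≤ ∑ i, (2 * k i - 1) :=
    Finset.single_le_sum (f := fun i => 2 * k i - 1) (by simp) (Finset.mem_univ i)
  obtain ⟨l, hl, hnd, hch, hlX, ⟨a, ha, hhead⟩, b, hb, hlast⟩ :=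
    exists_alternating_path G c U' W' X hne h1 h2 (k i - 2) (by omega)
  have hmem : ∀ a ∈ U', α ≤ x a ∧ ¬G.Adj v a ∧ 1 < codeg G v a ∧
      ∀ u ∈ X, ¬G.Adj u a := by
    intro a ha
    obtain ⟨h3, h4⟩ := Finset.mem_sdiff.1 (hU' ha)
    obtain ⟨h5, -, h6, h7⟩ := (Finset.mem_filter.1 h3).2
    refine ⟨h5, h6, h7, fun u hu hua => h4 (Finset.mem_union_right _ ?_)⟩
    exact Finset.mem_biUnion.2 ⟨u, hu, Finset.mem_filter.2 ⟨by simpa using hua, h5⟩⟩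
  have hlv : ∀ a ∈ l, ¬G.Adj v a := by
    intro a ha
    rcases Finset.mem_union.1 (hlX a ha).1 with h | h
    · exact (hmem a h).2.1
    · have := (Finset.mem_sdiff.1 (hW' h)).2
      simp only [Finset.mem_union, not_or, SimpleGraph.mem_neighborFinset] at this
      exact this.1
  obtain ⟨u, hu⟩ := Finset.card_pos.1 ((Nat.zero_lt_one).trans (hmem a ha).2.2.1)
  obtain ⟨u', hu', huu'⟩ := Finset.exists_mem_ne (hmem b hb).2.2.1 u
  obtain ⟨hvu, hua⟩ := Finset.mem_filter.1 hu
  obtain ⟨hvu', hub⟩ := Finset.mem_filter.1 hu'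
  rw [SimpleGraph.mem_neighborFinset] at hvu hvu'
  refine ⟨u :: (l ++ [u']), ?_, ?_, ?_, ?_, ?_, ?_⟩
  · simp only [List.length_cons, List.length_append, hl, List.length_nil]
    omega
  · have h3 : u ∉ l := fun h => hlv u h hvu
    have h4 : u' ∉ l := fun h => hlv u' h hvu'
    simp only [List.nodup_cons, List.mem_append, h3, huu'.symm,
      not_false_eq_true, true_and, List.nodup_append, hnd, List.nodup_nil, List.not_mem_nil,
      and_self, List.mem_cons, or_false, forall_eq]
    exact fun a ha e => h4 (e ▸ ha)
  · rw [List.isChain_cons, List.isChain_append]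
    refine ⟨?_, hch, by simp, ?_⟩
    · simpa [hhead] using hua
    · simpa [hlast] using hub.symm
  · intro y hy
    simp only [List.mem_cons, List.mem_append, List.not_mem_nil, or_false] at hy
    rcases hy with rfl | hy | rfl
    · exact fun h => (hmem a ha).2.2.2 _ h hua
    · exact (hlX y hy).2
    · exact fun h => (hmem b hb).2.2.2 _ h hub
  · simpa using hvu
  · simpa [List.getLast?_cons] using hvu'

/-! ### Stability: the heavy vertices -/

/-- Vertices of small degree have small weight. The largest weight `m` of such a vertex satisfies
`κ n m ≤ n m + o(n)`, because all but few of the heavy vertices have at most one common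
neighbour with it, and `κ ≥ 2`. -/
lemma weight_lt_of_degree_lt {t : ℕ} {k : Fin t → ℕ} (hk : ∀ i, 2 ≤ k i) {κ : ℕ} (hκ : 2 ≤ κ)
    {η : ℝ} (hη : 0 < η) :
    ∃ ε : ℝ, 0 < ε ∧ ∃ N : ℕ, ∀ n, N ≤ n → ∀ (G : SimpleGraph (Fin n)) [DecidableRel G.Adj],
      (intersectingCycles fun i => 2 * k i).Free G → ∀ (μ : ℝ) (x : Fin n → ℝ), IsPerron G κ μ x →
      ∀ v, G.degree v < ε * n → x v < η := by
  set c : ℕ := 2 * (1 + ∑ i, (2 * k i - 1)) with hc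
  have hc0 : (0 : ℝ) ≤ c := Nat.cast_nonneg c
  have hκ2 : (2 : ℝ) ≤ κ := by exact_mod_cast hκ
  set ε : ℝ := η / (4 * (6 * c + 1)) with hεdef
  have hε : 0 < ε := by positivity
  obtain ⟨N₁, hN₁⟩ := card_heavy_codeg_lt hk (κ := κ) (by omega) hε hε
  obtain ⟨N₂, hN₂⟩ := exists_nat_ge (2 * (κ : ℝ) ^ 2 + 8 * c / (ε ^ 2 * η) + 1)
  refine ⟨ε, hε, max N₁ N₂, fun n hn G _ hG μ x hx v hv => ?_⟩
  have hB := hN₁ n ((le_max_left _ _).trans hn) G hG μ x hx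
  have hnN : (N₂ : ℝ) ≤ n := by exact_mod_cast (le_max_right _ _).trans hn
  have h0 : 0 ≤ 8 * c / (ε ^ 2 * η) := by positivity
  have hn1 : (1 : ℝ) ≤ n := by nlinarith [sq_nonneg (κ : ℝ)]
  have hnκ : 2 * (κ : ℝ) ^ 2 ≤ n := by linarith
  have hnε : 8 * c / (ε ^ 2 * η) < n := by nlinarith [sq_nonneg (κ : ℝ)]
  have hsp : LocallySparse G c := sum_card_filter_adj_le hk hG
  have : Nonempty (Fin n) := ⟨v⟩
  set K := Finset.univ.filter fun v => ε * n ≤ G.degree v with hK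
  have hKc : (K.card : ℝ) ≤ 2 * c / ε ^ 2 := by
    have := hsp.card_high_degree_le hε
    rwa [Fintype.card_fin] at this
  -- A vertex of maximum weight among those of low degree.
  obtain ⟨w₀, hw₀, hmax⟩ := Finset.exists_max_image Kᶜ x ⟨v, by simp [hK, hv]⟩
  have hlow : ∀ w, w ∉ K → x w ≤ x w₀ := fun w hw => hmax w (Finset.mem_compl.2 hw)
  refine (hlow v (by simp [hK, hv])).trans_lt ?_
  have hd : G.degree w₀ < ε * n := by simpa [hK] using hw₀
  set m := x w₀ with hm
  have hm0 : 0 ≤ m := hx.nonneg w₀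
  set B := Finset.univ.filter fun w => ε ≤ x w ∧ w ≠ w₀ ∧ ¬G.Adj w₀ w ∧ 2 ≤ codeg G w₀ w with hBdef
  have hpt : ∀ w, (codeg G w₀ w : ℝ) * x w ≤ ε * codeg G w₀ w +
      (if w = w₀ then (codeg G w₀ w : ℝ) else 0) +
      (if w ∈ G.neighborFinset w₀ then (codeg G w₀ w : ℝ) else 0) +
      (if w ∈ B then (codeg G w₀ w : ℝ) else 0) + (if w ∈ K then 1 else 0) + m := by
    intro w
    have hcw : (0 : ℝ) ≤ codeg G w₀ w := Nat.cast_nonneg _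
    have hxw := hx.nonneg w
    have hxw1 := hx.le_one w
    have h1 : (codeg G w₀ w : ℝ) * x w ≤ codeg G w₀ w := mul_le_of_le_one_right hcw hxw1
    have h2 : (0 : ℝ) ≤ ε * codeg G w₀ w := by positivity
    have i1 : (0 : ℝ) ≤ if w = w₀ then (codeg G w₀ w : ℝ) else 0 := by split_ifs <;> simp
    have i2 : (0 : ℝ) ≤ if w ∈ G.neighborFinset w₀ then (codeg G w₀ w : ℝ) else 0 := by
      split_ifs <;> simp
    have i3 : (0 : ℝ) ≤ if w ∈ B then (codeg G w₀ w : ℝ) else 0 := by split_ifs <;> simp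
    have i4 : (0 : ℝ) ≤ if w ∈ K then 1 else 0 := by split_ifs <;> simp
    by_cases hα : x w < ε
    · have : (codeg G w₀ w : ℝ) * x w ≤ ε * codeg G w₀ w := by
        rw [mul_comm]; exact mul_le_mul_of_nonneg_right hα.le hcw
      linarith
    by_cases e1 : w = w₀
    · rw [if_pos e1] at i1 ⊢; linarith
    by_cases e2 : w ∈ G.neighborFinset w₀
    · rw [if_pos e2] at i2 ⊢; linarith
    by_cases e3 : w ∈ B
    · rw [if_pos e3] at i3 ⊢; linarith
    have h3 : codeg G w₀ w ≤ 1 := by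
      by_contra! h4
      exact e3 (Finset.mem_filter.2 ⟨Finset.mem_univ _, not_lt.1 hα, e1, by simpa using e2, h4⟩)
    have h4 : (codeg G w₀ w : ℝ) ≤ 1 := by exact_mod_cast h3
    have h5 : (codeg G w₀ w : ℝ) * x w ≤ x w := mul_le_of_le_one_left hxw h4
    by_cases e4 : w ∈ K
    · rw [if_pos e4] at i4 ⊢; linarith
    · have := hlow w e4
      linarith
  have hsum := Finset.sum_le_sum fun w (_ : w ∈ Finset.univ) => hpt w
  rw [← hx.sq_mul] at hsum
  simp only [Finset.sum_add_distrib, ← Finset.mul_sum, Finset.sum_ite_eq', Finset.mem_univ, if_true,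
    Finset.sum_ite_mem, Finset.univ_inter, Finset.sum_const, nsmul_eq_mul, mul_one, codeg_self,
    Finset.card_univ, Fintype.card_fin] at hsum
  have s1 := hsp.sum_codeg_univ_le w₀
  have s2 := hsp.sum_codeg_le w₀ (G.neighborFinset w₀)
  have s3 := hsp.sum_codeg_le w₀ B
  rw [SimpleGraph.card_neighborFinset_eq_degree] at s2
  rw [Fintype.card_fin] at s1
  have s4 := hB w₀
  rw [← hBdef] at s4
  have hle := hx.le_sq
  rw [Fintype.card_fin] at hle
  have t1 : ε * ∑ w, (codeg G w₀ w : ℝ) ≤ ε * (2 * c * n) := by gcongr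
  have t2 : (c : ℝ) * (G.degree w₀ + G.degree w₀) ≤ c * (ε * n + ε * n) := by gcongr
  have t3 : (c : ℝ) * (G.degree w₀ + B.card) ≤ c * (ε * n + ε * n) := by gcongr
  have t4 : κ * (n - κ) * m ≤ μ ^ 2 * m := mul_le_mul_of_nonneg_right hle hm0
  have t5 : (n / 2 + n) * m ≤ κ * (n - κ) * m := by
    refine mul_le_mul_of_nonneg_right ?_ hm0
    nlinarith
  have t6 : (6 * c + 1) * ε = η / 4 := by rw [hεdef]; field_simp
  have t7 : 2 * c / ε ^ 2 < η / 4 * n := by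
    rw [div_lt_iff₀ (by positivity)] at hnε ⊢
    nlinarith
  have t8 : n / 2 * m < n / 2 * η := by
    have : (6 * c + 1) * ε * n = η / 4 * n := by rw [t6]
    linarith
  exact lt_of_mul_lt_mul_left t8 (by positivity)

/-- The common neighbours of the vertices in `S`. -/
def commonNbrs {V : Type*} [Fintype V] (G : SimpleGraph V) [DecidableRel G.Adj] (S : Finset V) :
    Finset V :=
  Finset.univ.filter fun u => ∀ s ∈ S, G.Adj s u

lemma mem_commonNbrs {V : Type*} [Fintype V] {G : SimpleGraph V} [DecidableRel G.Adj]
    {S : Finset V} {u : V} : u ∈ commonNbrs G S ↔ ∀ s ∈ S, G.Adj s u := by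
  simp [commonNbrs]

/-- In a graph without intersecting cycles, `κ + 1` vertices have few common neighbours. -/
lemma card_common_neighbors_lt {V : Type*} [Fintype V] [DecidableEq V] {G : SimpleGraph V}
    [DecidableRel G.Adj] {t : ℕ} {k : Fin t → ℕ} (hk : ∀ i, 2 ≤ k i)
    (hG : (intersectingCycles fun i => 2 * k i).Free G) (S : Finset V)
    (hS : S.card = ∑ i, (k i - 1) + 1) :
    (commonNbrs G S).card < 1 + ∑ i, (2 * k i - 1) := by
  by_contra! h
  exact hG (intersectingCycles_isContained_of_completeBipartite hk S _ hS h
    fun s hs c hc => mem_commonNbrs.1 hc s hs)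

/-- Only boundedly many vertices are adjacent to more than `κ` vertices of a given set `L`, so on
average a vertex has at most `κ` neighbours in `L`. -/
lemma sum_codeg_le_of_free {V : Type*} [Fintype V] [DecidableEq V] {G : SimpleGraph V}
    [DecidableRel G.Adj] {t : ℕ} {k : Fin t → ℕ} (hk : ∀ i, 2 ≤ k i)
    (hG : (intersectingCycles fun i => 2 * k i).Free G) (L : Finset V) (v : V) :
    ∑ w ∈ L, codeg G v w ≤ (∑ i, (k i - 1)) * G.degree v +
      2 ^ L.card * (1 + ∑ i, (2 * k i - 1)) * L.card := by
  set κ := ∑ i, (k i - 1) with hκ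
  set M := 1 + ∑ i, (2 * k i - 1) with hM
  let Q := (L.powersetCard (κ + 1)).biUnion fun T => commonNbrs G T
  have hQ : Q.card ≤ 2 ^ L.card * M := by
    refine (Finset.card_biUnion_le_card_mul _ _ M fun T hT => ?_).trans ?_
    · exact (card_common_neighbors_lt hk hG T (Finset.mem_powersetCard.1 hT).2).le
    · refine Nat.mul_le_mul_right _ ?_
      rw [← Finset.card_powerset]
      exact Finset.card_le_card fun T hT =>
        Finset.mem_powerset.2 (Finset.mem_powersetCard.1 hT).1
  have hpt : ∀ u, (L.filter (G.Adj u)).card ≤ κ + if u ∈ Q then L.card else 0 := by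
    intro u
    by_cases hu : u ∈ Q
    · rw [if_pos hu]
      exact (Finset.card_filter_le _ _).trans (Nat.le_add_left _ _)
    · rw [if_neg hu]
      by_contra! h
      obtain ⟨T, hT, hTc⟩ := Finset.exists_subset_card_eq (Nat.succ_le_of_lt h)
      refine hu (Finset.mem_biUnion.2 ⟨T, Finset.mem_powersetCard.2
        ⟨hT.trans (Finset.filter_subset _ _), by simpa using hTc⟩, ?_⟩)
      exact mem_commonNbrs.2 fun s hs => (Finset.mem_filter.1 (hT hs)).2.symm
  rw [sum_codeg]
  refine (Finset.sum_le_sum fun u _ => hpt u).trans ?_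
  rw [Finset.sum_add_distrib, Finset.sum_const, smul_eq_mul,
    SimpleGraph.card_neighborFinset_eq_degree, mul_comm]
  refine Nat.add_le_add_left ?_ _
  rw [Finset.sum_ite_mem, Finset.sum_const, smul_eq_mul]
  exact Nat.mul_le_mul_right _ ((Finset.card_le_card Finset.inter_subset_right).trans hQ)

/-- A bounded set `L` that contains all vertices of non-negligible weight. -/
lemma exists_heavy_set {t : ℕ} {k : Fin t → ℕ} (hk : ∀ i, 2 ≤ k i) {κ : ℕ}
    (hκ : κ = ∑ i, (k i - 1)) (hκ2 : 2 ≤ κ) {η : ℝ} (hη : 0 < η) :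
    ∃ N : ℕ, ∀ n, N ≤ n → ∀ (G : SimpleGraph (Fin n)) [DecidableRel G.Adj],
      (intersectingCycles fun i => 2 * k i).Free G → ∀ (μ : ℝ) (x : Fin n → ℝ), IsPerron G κ μ x →
      ∃ L : Finset (Fin n), (∀ w, w ∉ L → x w < η) ∧
        ∀ v, (∑ w ∈ L, (codeg G v w : ℝ)) ≤ κ * G.degree v + η * n := by
  set M := 1 + ∑ i, (2 * k i - 1) with hM
  obtain ⟨ε, hε, N₁, hN₁⟩ := weight_lt_of_degree_lt hk hκ2 hη
  obtain ⟨b, hb⟩ := exists_nat_ge (2 * ((2 * M : ℕ) : ℝ) / ε ^ 2)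
  obtain ⟨N₂, hN₂⟩ := exists_nat_ge (2 ^ b * M * b / η)
  refine ⟨max N₁ (max N₂ 1), fun n hn G _ hG μ x hx => ?_⟩
  simp only [max_le_iff] at hn
  have : Nonempty (Fin n) := ⟨⟨0, by omega⟩⟩
  have hsp : LocallySparse G (2 * M) := sum_card_filter_adj_le hk hG
  refine ⟨Finset.univ.filter fun w => η ≤ x w, fun w hw => by simpa using hw, fun v => ?_⟩
  set L := Finset.univ.filter fun w => η ≤ x w with hL
  have hLb : L.card ≤ b := by
    have h1 : L ⊆ Finset.univ.filter fun v => ε * Fintype.card (Fin n) ≤ G.degree v := by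
      intro w hw
      rw [Finset.mem_filter, Fintype.card_fin] at *
      refine ⟨Finset.mem_univ _, ?_⟩
      by_contra! h
      exact (hN₁ n hn.1 G hG μ x hx w h).not_ge hw.2
    have h2 : (L.card : ℝ) ≤ b := by
      refine le_trans ?_ ((hsp.card_high_degree_le hε).trans hb)
      exact_mod_cast Finset.card_le_card h1
    exact_mod_cast h2
  have h1 : ∑ w ∈ L, codeg G v w ≤ κ * G.degree v + 2 ^ b * M * b := by
    refine (sum_codeg_le_of_free hk hG L v).trans ?_
    rw [hκ]
    gcongr
    exact one_le_two
  have h2 : (2 ^ b * M * b : ℝ) ≤ η * n := by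
    have : (N₂ : ℝ) ≤ n := by exact_mod_cast hn.2.1
    have := hN₂.trans this
    rw [div_le_iff₀ hη] at this
    linarith
  have h3 : (∑ w ∈ L, (codeg G v w : ℝ)) ≤ κ * G.degree v + 2 ^ b * M * b := by exact_mod_cast h1
  linarith

/-- Vertices of almost full degree have almost full common neighbourhood. -/
lemma card_sub_le_common_neighbors {V : Type*} [Fintype V] [DecidableEq V] (G : SimpleGraph V)
    [DecidableRel G.Adj] (S : Finset V) {d : ℝ} (h : ∀ s ∈ S, Fintype.card V - d ≤ G.degree s) :
    Fintype.card V - S.card * d ≤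
      ((commonNbrs G S).card : ℝ) := by
  have h1 : (commonNbrs G S)ᶜ ⊆
      S.biUnion fun s => (G.neighborFinset s)ᶜ := by
    intro u hu
    simp only [Finset.mem_compl, mem_commonNbrs, not_forall] at hu
    obtain ⟨s, hs, hsu⟩ := hu
    exact Finset.mem_biUnion.2 ⟨s, hs, by simpa using hsu⟩
  have h2 := (Finset.card_le_card h1).trans Finset.card_biUnion_le
  have h3 : (((commonNbrs G S)ᶜ.card : ℕ) : ℝ) ≤ S.card * d := by
    refine (Nat.cast_le.2 h2).trans ?_
    rw [Nat.cast_sum, ← nsmul_eq_mul]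
    refine Finset.sum_le_card_nsmul _ _ _ fun s hs => ?_
    rw [Finset.card_compl, Nat.cast_sub (Finset.card_le_univ _),
      SimpleGraph.card_neighborFinset_eq_degree]
    linarith [h s hs]
  rw [Finset.card_compl, Nat.cast_sub (Finset.card_le_univ _)] at h3
  linarith

/-- Stability: there are exactly `κ` vertices of weight close to `1`, almost all vertices are
adjacent to all of them, and the remaining vertices have small weight. -/
lemma exists_dominating_set {t : ℕ} {k : Fin t → ℕ} (hk : ∀ i, 2 ≤ k i) {κ : ℕ}
    (hκ : κ = ∑ i, (k i - 1)) (hκ2 : 2 ≤ κ) {θ : ℝ} (hθ : 0 < θ) (hθκ : θ * (4 * (κ + 1)) ≤ 1) :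
    ∃ N : ℕ, ∀ n, N ≤ n → ∀ (G : SimpleGraph (Fin n)) [DecidableRel G.Adj],
      (intersectingCycles fun i => 2 * k i).Free G → ∀ (μ : ℝ) (x : Fin n → ℝ), IsPerron G κ μ x →
      ∃ S : Finset (Fin n), S.card = κ ∧ (∀ s ∈ S, 1 - θ ≤ x s) ∧
        (n - κ * (2 * θ * n) ≤ ((commonNbrs G S).card : ℝ)) ∧
        ∀ v, v ∉ S → x v ≤ (2 * κ + 1) * θ := by
  set M := 1 + ∑ i, (2 * k i - 1) with hM
  have hκ2' : (2 : ℝ) ≤ κ := by exact_mod_cast hκ2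
  have hθ1 : θ ≤ 1 / 12 := by nlinarith
  set β : ℝ := θ ^ 2 / 4 with hβ
  have hβ0 : 0 < β := by positivity
  have hβθ : β ≤ θ / 48 := by nlinarith
  set c : ℝ := ((2 * M : ℕ) : ℝ) with hc
  have hc0 : 0 ≤ c := Nat.cast_nonneg _
  set η : ℝ := β / (2 * c + 2) with hηdef
  have hη : 0 < η := by positivity
  have hηβ : (2 * c + 2) * η = β := by rw [hηdef]; field_simp
  obtain ⟨N₁, hN₁⟩ := exists_heavy_set hk hκ hκ2 hη
  obtain ⟨N₂, hN₂⟩ := exists_nat_ge (κ ^ 2 / η + 4 * M / θ + 1)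
  refine ⟨max N₁ N₂, fun n hn G _ hG μ x hx => ?_⟩
  obtain ⟨L, hL, hLs⟩ := hN₁ n ((le_max_left _ _).trans hn) G hG μ x hx
  have hnN : (N₂ : ℝ) ≤ n := by exact_mod_cast (le_max_right _ _).trans hn
  have hp1 : (0 : ℝ) ≤ κ ^ 2 / η := by positivity
  have hp2 : (0 : ℝ) ≤ 4 * M / θ := by positivity
  have hn1 : (1 : ℝ) ≤ n := by linarith
  have hκn : (κ : ℝ) ^ 2 ≤ η * n := by
    have : κ ^ 2 / η ≤ n := by linarith
    rw [div_le_iff₀ hη] at this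
    linarith
  have hMn : M ≤ θ * n / 4 := by
    have : 4 * M / θ ≤ n := by linarith
    rw [div_le_iff₀ hθ] at this
    linarith
  have hsp : LocallySparse G (2 * M) := sum_card_filter_adj_le hk hG
  have hle := hx.le_sq
  rw [Fintype.card_fin] at hle
  have hdn : ∀ v, (G.degree v : ℝ) ≤ n := fun v => by
    exact_mod_cast (degree_le_card v).trans (Fintype.card_fin n).le
  have hwalk : ∀ v, (κ * n - η * n) * x v ≤
      (∑ w ∈ L, (codeg G v w : ℝ) * x w) + 2 * c * η * n := by
    intro v
    have h1 : (κ * n - η * n) * x v ≤ μ ^ 2 * x v := by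
      refine mul_le_mul_of_nonneg_right ?_ (hx.nonneg v)
      linarith
    refine h1.trans ?_
    rw [hx.sq_mul, ← Finset.sum_add_sum_compl L]
    refine add_le_add le_rfl ?_
    calc ∑ w ∈ Lᶜ, (codeg G v w : ℝ) * x w ≤ ∑ w ∈ Lᶜ, (codeg G v w : ℝ) * η :=
          Finset.sum_le_sum fun w hw => mul_le_mul_of_nonneg_left
            (hL w (Finset.mem_compl.1 hw)).le (Nat.cast_nonneg _)
      _ ≤ (∑ w, (codeg G v w : ℝ)) * η := by
          rw [← Finset.sum_mul]
          refine mul_le_mul_of_nonneg_right ?_ hη.le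
          exact Finset.sum_le_sum_of_subset_of_nonneg (Finset.subset_univ _)
            fun _ _ _ => Nat.cast_nonneg _
      _ ≤ 2 * c * n * η := by
          refine mul_le_mul_of_nonneg_right ?_ hη.le
          have := hsp.sum_codeg_univ_le v
          rwa [Fintype.card_fin] at this
      _ = _ := by ring
  have hdeg : ∀ v, n * x v ≤ G.degree v + β / 2 * n := by
    intro v
    have h1 : ∑ w ∈ L, (codeg G v w : ℝ) * x w ≤ ∑ w ∈ L, (codeg G v w : ℝ) :=
      Finset.sum_le_sum fun w _ => mul_le_of_le_one_right (Nat.cast_nonneg _) (hx.le_one w)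
    have h2 := hwalk v
    have h3 := hLs v
    have h4 : η * n * x v ≤ η * n := mul_le_of_le_one_right (by positivity) (hx.le_one v)
    have h5 : (2 * c + 2) * η * n = β * n := by rw [hηβ]
    have h6 : (κ : ℝ) * (n * x v) ≤ κ * (G.degree v + β / 2 * n) := by
      have : 2 * (β / 2 * n) ≤ κ * (β / 2 * n) := mul_le_mul_of_nonneg_right hκ2' (by positivity)
      linarith
    exact le_of_mul_le_mul_left h6 (by linarith)
  obtain ⟨z, hz⟩ := hx.exists_eq_one
  let S := Finset.univ.filter fun w => 1 - θ ≤ x w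
  have hSx : ∀ s ∈ S, 1 - θ ≤ x s := fun s hs => (Finset.mem_filter.1 hs).2
  have hSd : ∀ s ∈ S, (Fintype.card (Fin n) : ℝ) - 2 * θ * n ≤ G.degree s := by
    intro s hs
    rw [Fintype.card_fin]
    have h1 := hdeg s
    have h2 : (n : ℝ) * (1 - θ) ≤ n * x s := mul_le_mul_of_nonneg_left (hSx s hs) (by linarith)
    have h3 : β / 2 * n ≤ θ * n := mul_le_mul_of_nonneg_right (by linarith) (by linarith)
    linarith
  -- By the weighted count of walks from `z`, at least `κ` vertices have weight close to `1`.
  have hSκ : κ ≤ S.card := by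
    have h1 := hwalk z
    rw [hz, mul_one] at h1
    have h2 := hLs z
    have h3 : (κ : ℝ) * G.degree z ≤ κ * n := mul_le_mul_of_nonneg_left (hdn z) (by linarith)
    have h4 : ∀ w ∈ L, θ * codeg G z w ≤ (codeg G z w - codeg G z w * x w) +
        if w ∈ S then θ * n else 0 := by
      intro w _
      have i1 : (0 : ℝ) ≤ codeg G z w := Nat.cast_nonneg _
      have i2 : (codeg G z w : ℝ) ≤ n := by
        exact_mod_cast (codeg_le_card z w).trans (Fintype.card_fin n).le
      by_cases hw : w ∈ S
      · rw [if_pos hw]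
        have := mul_le_mul_of_nonneg_left i2 hθ.le
        have := mul_le_of_le_one_right i1 (hx.le_one w)
        linarith
      · rw [if_neg hw]
        have h5 : x w < 1 - θ := by
          simpa only [S, Finset.mem_filter, Finset.mem_univ, true_and, not_le] using hw
        have := mul_le_mul_of_nonneg_left h5.le i1
        linarith
    have h5 := Finset.sum_le_sum h4
    rw [← Finset.mul_sum, Finset.sum_add_distrib, Finset.sum_sub_distrib, Finset.sum_ite_mem,
      Finset.sum_const, nsmul_eq_mul] at h5
    have h6 : ((L ∩ S).card : ℝ) * (θ * n) ≤ S.card * (θ * n) := by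
      refine mul_le_mul_of_nonneg_right ?_ (by positivity)
      exact_mod_cast Finset.card_le_card Finset.inter_subset_right
    have h7 : (2 * c + 2) * η * n = β * n := by rw [hηβ]
    have h8 : (0 : ℝ) ≤ η * n := by positivity
    have h9 : (0 : ℝ) ≤ c * η * n := by positivity
    have h10 : (1 - θ) * (∑ w ∈ L, (codeg G z w : ℝ)) ≤ (1 - θ) * (κ * n + β * n) :=
      mul_le_mul_of_nonneg_left (by linarith) (by linarith)
    have h11 : (κ - θ / 2) * (θ * n) ≤ S.card * (θ * n) := by
      have : β * n = θ / 4 * (θ * n) := by rw [hβ]; ring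
      have : 0 ≤ θ * (β * n) := by positivity
      linarith
    have h12 := le_of_mul_le_mul_right h11 (by positivity)
    have h13 : (κ : ℝ) < S.card + 1 := by linarith
    exact Nat.lt_succ_iff.1 (by exact_mod_cast h13)
  have hScard : S.card = κ := by
    refine le_antisymm ?_ hSκ
    by_contra! h
    obtain ⟨T, hTS, hT⟩ := Finset.exists_subset_card_eq (Nat.succ_le_of_lt h)
    have h1 := card_common_neighbors_lt hk hG T (by rw [hT, hκ])
    have h2 := card_sub_le_common_neighbors G T fun s hs => hSd s (hTS hs)
    rw [hT, Fintype.card_fin] at h2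
    have h3 : ((commonNbrs G T).card : ℝ) < M := Nat.cast_lt.2 h1
    push_cast at h2
    have h4 : θ * (4 * (κ + 1)) * n ≤ 1 * n := mul_le_mul_of_nonneg_right hθκ (by linarith)
    have h5 : θ * n ≤ 1 / 12 * n := mul_le_mul_of_nonneg_right hθ1 (by linarith)
    linarith
  have hcommon := card_sub_le_common_neighbors G S hSd
  rw [hScard, Fintype.card_fin] at hcommon
  refine ⟨S, hScard, hSx, hcommon, fun v hv => ?_⟩
  have h1 := card_common_neighbors_lt hk hG (insert v S)
    (by rw [Finset.card_insert_of_notMem hv, hScard, hκ])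
  have h2 : G.degree v ≤ (commonNbrs G (insert v S)).card +
      (commonNbrs G S)ᶜ.card := by
    rw [← SimpleGraph.card_neighborFinset_eq_degree]
    refine (Finset.card_le_card fun u hu => ?_).trans (Finset.card_union_le _ _)
    rw [SimpleGraph.mem_neighborFinset] at hu
    simp only [Finset.mem_union, mem_commonNbrs, Finset.mem_compl, Finset.forall_mem_insert, hu,
      true_and]
    exact em _
  rw [Finset.card_compl, Fintype.card_fin] at h2
  have h3 : (G.degree v : ℝ) ≤ M + (n - (commonNbrs G S).card) := by
    rw [← Nat.cast_sub ((Finset.card_le_univ _).trans (Fintype.card_fin n).le), ← Nat.cast_add]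
    exact Nat.cast_le.2 (h2.trans (Nat.add_le_add_right h1.le _))
  have h4 := hdeg v
  have h5 : β / 2 * n ≤ θ / 2 * n := mul_le_mul_of_nonneg_right (by linarith) (by linarith)
  have h6 : (n : ℝ) * x v ≤ n * ((2 * κ + 1) * θ) := by
    have : 0 < θ * n := by positivity
    linarith
  exact le_of_mul_le_mul_left h6 (by linarith)

/-! ### The structure of extremal graphs -/

/-- The graph obtained from `G` by replacing the neighbourhood of `v` by `S`. -/
def rewire {V : Type*} (G : SimpleGraph V) (S : Finset V) (v : V) : SimpleGraph V where
  Adj a b := a ≠ b ∧ ((a ≠ v ∧ b ≠ v ∧ G.Adj a b) ∨ (a = v ∧ b ∈ S) ∨ (b = v ∧ a ∈ S))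
  symm := ⟨fun a b h => ⟨h.1.symm, by
    rcases h.2 with ⟨h1, h2, h3⟩ | h | h
    · exact Or.inl ⟨h2, h1, h3.symm⟩
    · exact Or.inr (Or.inr h)
    · exact Or.inr (Or.inl h)⟩⟩
  loopless := ⟨fun a h => h.1 rfl⟩

lemma rewire_adj {V : Type*} {G : SimpleGraph V} {S : Finset V} {v a b : V} :
    (rewire G S v).Adj a b ↔
      a ≠ b ∧ ((a ≠ v ∧ b ≠ v ∧ G.Adj a b) ∨ (a = v ∧ b ∈ S) ∨ (b = v ∧ a ∈ S)) :=
  Iff.rfl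

lemma neighborFinset_rewire {V : Type*} [Fintype V] {G : SimpleGraph V} {S : Finset V} {v : V}
    (hv : v ∉ S) [DecidableRel (rewire G S v).Adj] : (rewire G S v).neighborFinset v = S := by
  ext u
  rw [SimpleGraph.mem_neighborFinset, rewire_adj]
  constructor
  · rintro ⟨h, h' | h' | h'⟩
    · exact absurd rfl h'.1
    · exact h'.2
    · exact absurd h'.1.symm h
  · exact fun h => ⟨fun e => hv (e ▸ h), Or.inr (Or.inl ⟨rfl, h⟩)⟩

/-- Replacing the neighbourhood of a vertex by a set with many common neighbours creates no new
small subgraphs, as an unused common neighbour can take over the role of that vertex. -/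
lemma rewire_free {V W : Type*} [Fintype V] [DecidableEq V] [Fintype W] {A : SimpleGraph W}
    {G : SimpleGraph V} [DecidableRel G.Adj] (hG : A.Free G) {S : Finset V} {v : V}
    (hC : Fintype.card W < (commonNbrs G S).card) : A.Free (rewire G S v) := by
  rintro ⟨f⟩
  obtain ⟨c, hc, hcf⟩ := Finset.exists_mem_notMem_of_card_lt_card
    ((Finset.card_image_le (s := Finset.univ) (f := f)).trans_lt hC)
  have hcf' : ∀ w, f w ≠ c := fun w h => hcf (Finset.mem_image.2 ⟨w, Finset.mem_univ _, h⟩)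
  rw [mem_commonNbrs] at hc
  refine hG ⟨⟨⟨fun w => if f w = v then c else f w, ?_⟩, ?_⟩⟩
  · intro a b hab
    have h := (f.toHom.map_adj hab)
    simp only [SimpleGraph.Copy.toHom_apply] at h
    obtain ⟨hne, h⟩ := h
    rcases h with ⟨h1, h2, h3⟩ | ⟨h1, h2⟩ | ⟨h1, h2⟩
    · simpa [h1, h2] using h3
    · have h3 : f b ≠ v := fun e => hne (h1.trans e.symm)
      simpa [h1, h3] using (hc _ h2).symm
    · have h3 : f a ≠ v := fun e => hne (e.trans h1.symm)
      simpa [h1, h3] using hc _ h2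
  · intro a b hab
    simp only [RelHom.coeFn_mk] at hab
    split_ifs at hab with h1 h2 h2
    · exact f.injective (h1.trans h2.symm)
    · exact absurd hab.symm (hcf' _)
    · exact absurd hab (hcf' _)
    · exact f.injective hab

/-- The contribution of a vertex `v` to the quadratic form. -/
lemma adjForm_eq_add {V : Type*} [Fintype V] [DecidableEq V] (G : SimpleGraph V)
    [DecidableRel G.Adj] (x : V → ℝ) (v : V) :
    adjForm G x = 2 * (x v * ∑ u ∈ G.neighborFinset v, x u) +
      ∑ a ∈ Finset.univ.erase v, x a * ∑ b ∈ (G.neighborFinset a).erase v, x b := by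
  have h1 : ∀ a ∈ Finset.univ.erase v, x a * ∑ b ∈ G.neighborFinset a, x b =
      (if G.Adj v a then x v * x a else 0) + x a * ∑ b ∈ (G.neighborFinset a).erase v, x b := by
    intro a _
    by_cases h : G.Adj v a
    · rw [if_pos h, ← Finset.add_sum_erase _ _ ((G.mem_neighborFinset a v).2 h.symm)]
      ring
    · rw [if_neg h, Finset.erase_eq_of_notMem, zero_add]
      exact fun h' => h ((G.mem_neighborFinset a v).1 h').symm
  rw [adjForm, ← Finset.add_sum_erase _ _ (Finset.mem_univ v), Finset.sum_congr rfl h1,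
    Finset.sum_add_distrib, ← Finset.sum_filter, ← Finset.mul_sum]
  have h2 : (Finset.univ.erase v).filter (G.Adj v) = G.neighborFinset v := by
    ext u
    simp only [Finset.mem_filter, Finset.mem_erase, Finset.mem_univ, and_true,
      SimpleGraph.mem_neighborFinset, and_iff_right_iff_imp]
    exact fun h => h.ne'
  rw [h2]
  ring

lemma adjForm_rewire {V : Type*} [Fintype V] [DecidableEq V] (G : SimpleGraph V)
    [DecidableRel G.Adj] {S : Finset V} {v : V} (hv : v ∉ S) [DecidableRel (rewire G S v).Adj]
    (x : V → ℝ) :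
    adjForm (rewire G S v) x =
      adjForm G x + 2 * (x v * (∑ u ∈ S, x u - ∑ u ∈ G.neighborFinset v, x u)) := by
  have h2 : ∀ a ∈ Finset.univ.erase v,
      ((rewire G S v).neighborFinset a).erase v = (G.neighborFinset a).erase v := by
    intro a ha
    have hav := Finset.ne_of_mem_erase ha
    ext u
    simp only [Finset.mem_erase, SimpleGraph.mem_neighborFinset, rewire_adj]
    constructor
    · rintro ⟨huv, -, h' | h' | h'⟩
      · exact ⟨huv, h'.2.2⟩
      · exact absurd h'.1 hav
      · exact absurd h'.1 huv
    · exact fun h => ⟨h.1, h.2.ne, Or.inl ⟨hav, h.1, h.2⟩⟩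
  rw [adjForm_eq_add _ x v, adjForm_eq_add G x v, neighborFinset_rewire hv,
    Finset.sum_congr (s₁ := Finset.univ.erase v) rfl fun a ha => by rw [h2 a ha]]
  ring

/-- Among the vertices outside `S` and its common neighbourhood there is one whose neighbours in
this exceptional set `E` have small total weight: otherwise the restriction of `x` to `E` would show
that the sparse graph on the few vertices of `E` has a large spectral radius. -/
lemma exists_light_vertex {V : Type*} [Fintype V] [DecidableEq V] {G : SimpleGraph V}
    [DecidableRel G.Adj] {c κ : ℕ} {μ : ℝ} {x : V → ℝ} (hG : LocallySparse G c)
    (hx : IsPerron G κ μ x) {E : Finset V} (hE : E.Nonempty)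
    (hsmall : (2 * κ + 3) ^ 2 * (2 * c * E.card) < (κ : ℝ) * (Fintype.card V - κ))
    (hout : ∀ v ∈ E, ∑ u ∈ (G.neighborFinset v).filter (· ∉ E), x u ≤ κ + 1) :
    ∃ v ∈ E, ∑ u ∈ (G.neighborFinset v).filter (· ∈ E), x u < 1 / 2 := by
  by_contra! hcon
  have h1 : ∀ v ∈ E, μ * x v ≤
      (2 * κ + 3) * ∑ u ∈ (G.neighborFinset v).filter (· ∈ E), x u := by
    intro v hv
    rw [← hx.eig, ← Finset.sum_filter_add_sum_filter_not _ (· ∈ E)]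
    have i1 := hout v hv
    have i2 := hcon v hv
    have i3 : (κ : ℝ) * (1 / 2) ≤ κ * ∑ u ∈ (G.neighborFinset v).filter (· ∈ E), x u :=
      mul_le_mul_of_nonneg_left i2 (Nat.cast_nonneg _)
    linarith
  obtain ⟨v, hv, hmax⟩ := Finset.exists_max_image E x hE
  have hv0 : 0 < x v := by
    by_contra! h0
    have h2 : ∑ u ∈ (G.neighborFinset v).filter (· ∈ E), x u ≤ 0 :=
      Finset.sum_nonpos fun u hu => (hmax u (Finset.mem_filter.1 hu).2).trans h0
    linarith [hcon v hv]
  have hκ0 : (0 : ℝ) ≤ 2 * κ + 3 := by positivity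
  have h2 : μ ^ 2 * x v ≤ (2 * κ + 3) ^ 2 * (2 * c * E.card) * x v := by
    have h3 : ∀ u ∈ (G.neighborFinset v).filter (· ∈ E),
        μ * x u ≤ (2 * κ + 3) * ((E.filter (G.Adj u)).card * x v) := by
      intro u hu
      refine (h1 u (Finset.mem_filter.1 hu).2).trans (mul_le_mul_of_nonneg_left ?_ hκ0)
      have h4 : (G.neighborFinset u).filter (· ∈ E) = E.filter (G.Adj u) := by
        ext w; simp [and_comm]
      rw [h4, ← nsmul_eq_mul]
      exact Finset.sum_le_card_nsmul _ _ _ fun w hw => hmax w (Finset.mem_filter.1 hw).1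
    have h4 : (∑ u ∈ (G.neighborFinset v).filter (· ∈ E), ((E.filter (G.Adj u)).card : ℝ)) ≤
        c * (E.card + E.card) := by
      have h5 := hG v ((G.neighborFinset v).filter (· ∈ E)) E
        fun u hu => (G.mem_neighborFinset v u).1 (Finset.mem_filter.1 hu).1
      have h6 : ((G.neighborFinset v).filter (· ∈ E)).card ≤ E.card :=
        Finset.card_le_card fun u hu => (Finset.mem_filter.1 hu).2
      exact_mod_cast h5.trans (Nat.mul_le_mul_left _ (Nat.add_le_add_right h6 _))
    calc μ ^ 2 * x v = μ * (μ * x v) := by ring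
      _ ≤ μ * ((2 * κ + 3) * ∑ u ∈ (G.neighborFinset v).filter (· ∈ E), x u) :=
        mul_le_mul_of_nonneg_left (h1 v hv) hx.index_nonneg
      _ = (2 * κ + 3) * ∑ u ∈ (G.neighborFinset v).filter (· ∈ E), μ * x u := by
        rw [← Finset.mul_sum]; ring
      _ ≤ (2 * κ + 3) * ∑ u ∈ (G.neighborFinset v).filter (· ∈ E),
          (2 * κ + 3) * ((E.filter (G.Adj u)).card * x v) :=
        mul_le_mul_of_nonneg_left (Finset.sum_le_sum h3) hκ0
      _ = (2 * κ + 3) ^ 2 * x v *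
          ∑ u ∈ (G.neighborFinset v).filter (· ∈ E), ((E.filter (G.Adj u)).card : ℝ) := by
        rw [← Finset.mul_sum, ← Finset.sum_mul]; ring
      _ ≤ (2 * κ + 3) ^ 2 * x v * (c * (E.card + E.card)) :=
        mul_le_mul_of_nonneg_left h4 (by positivity)
      _ = _ := by ring
  have h3 := le_of_mul_le_mul_right h2 hv0
  linarith [hx.le_sq]

/-- In an extremal graph all vertices outside the dominating set `S` are adjacent to all of `S`.
Otherwise rewiring a light exceptional vertex to `S` increases the spectral radius. -/
lemma adj_of_extremal {n : ℕ} {G : SimpleGraph (Fin n)} [DecidableRel G.Adj] {t : ℕ}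
    {k : Fin t → ℕ} (hk : ∀ i, 2 ≤ k i) {κ : ℕ} (hκ : κ = ∑ i, (k i - 1))
    (hG : (intersectingCycles fun i => 2 * k i).Free G)
    (hmax : ∀ H : SimpleGraph (Fin n), (intersectingCycles fun i => 2 * k i).Free H →
      graphIndex H ≤ graphIndex G)
    {x : Fin n → ℝ} (hx : IsPerron G κ (graphIndex G) x) {S : Finset (Fin n)} (hS : S.card = κ)
    (hSx : ∀ s ∈ S, 7 / 8 ≤ x s)
    (hSout : ∀ v, v ∉ S → (1 + ∑ i, (2 * k i - 1) : ℕ) * x v ≤ 1 / 4)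
    (hC : 1 + ∑ i, (2 * k i - 1) < (commonNbrs G S).card)
    (hsmall : (2 * κ + 3) ^ 2 * (2 * ((2 * (1 + ∑ i, (2 * k i - 1)) : ℕ) : ℝ) *
      (n - (commonNbrs G S).card)) < (κ : ℝ) * (n - κ)) :
    ∀ v, v ∉ S → ∀ s ∈ S, G.Adj s v := by
  classical
  set M := 1 + ∑ i, (2 * k i - 1) with hM
  set C := commonNbrs G S with hCdef
  have hsp : LocallySparse G (2 * M) := sum_card_filter_adj_le hk hG
  have hCS : ∀ u ∈ C, u ∉ S := fun u hu hs => G.loopless.irrefl u (mem_commonNbrs.1 hu u hs)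
  -- A vertex outside `S` has few neighbours in `C`.
  have hCw : ∀ v, v ∉ S → ∑ u ∈ (G.neighborFinset v).filter (· ∈ C), x u ≤ 1 / 4 := by
    intro v hv
    have h1 := card_common_neighbors_lt hk hG (insert v S)
      (by rw [Finset.card_insert_of_notMem hv, hS, hκ])
    have h2 : (G.neighborFinset v).filter (· ∈ C) = commonNbrs G (insert v S) := by
      ext u
      simp [mem_commonNbrs, C]
    obtain ⟨u₀, hu₀⟩ : ∃ u, u ∈ C := Finset.card_pos.1 ((Nat.zero_le _).trans_lt hC)
    have hM0 : (0 : ℝ) < M := by rw [hM]; push_cast; positivity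
    have h3 : ∀ u ∈ (G.neighborFinset v).filter (· ∈ C), x u ≤ 1 / 4 / M := by
      intro u hu
      rw [le_div_iff₀ hM0, mul_comm]
      exact hSout u (hCS u (Finset.mem_filter.1 hu).2)
    refine (Finset.sum_le_card_nsmul _ _ _ h3).trans ?_
    rw [nsmul_eq_mul, h2]
    have h4 : ((commonNbrs G (insert v S)).card : ℝ) ≤ M := Nat.cast_le.2 h1.le
    calc _ ≤ (M : ℝ) * (1 / 4 / M) := mul_le_mul_of_nonneg_right h4 (by positivity)
      _ = 1 / 4 := by field_simp
  by_contra! hcon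
  obtain ⟨v₀, hv₀S, s₀, hs₀, hv₀⟩ := hcon
  let E : Finset (Fin n) := (S ∪ C)ᶜ
  have hEm : ∀ u, u ∈ E ↔ u ∉ S ∧ u ∉ C := by simp [E]
  have hEc : (E.card : ℝ) ≤ n - C.card := by
    have h1 : E.card + C.card ≤ n := by
      have h2 : Disjoint E C := Finset.disjoint_left.2 fun u hu hu' => ((hEm u).1 hu).2 hu'
      rw [← Finset.card_union_of_disjoint h2]
      exact (Finset.card_le_univ _).trans (Fintype.card_fin n).le
    have : (E.card : ℝ) + C.card ≤ n := by exact_mod_cast h1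
    linarith
  -- The neighbours of an exceptional vertex, split into those in `S`, in `C` and in `E`.
  have hsplit : ∀ v ∈ E, ∑ u ∈ (G.neighborFinset v).filter (· ∉ E), x u ≤
      ∑ u ∈ (G.neighborFinset v).filter (· ∈ S), x u + 1 / 4 := by
    intro v hv
    have h1 : (G.neighborFinset v).filter (· ∉ E) ⊆
        (G.neighborFinset v).filter (· ∈ S) ∪ (G.neighborFinset v).filter (· ∈ C) := by
      intro u hu
      simp only [Finset.mem_filter, Finset.mem_union, hEm] at hu ⊢
      tauto
    have h2 := Finset.sum_le_sum_of_subset_of_nonneg h1 (f := x) fun u _ _ => hx.nonneg u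
    have h3 := Finset.sum_union_inter (s₁ := (G.neighborFinset v).filter (· ∈ S))
      (s₂ := (G.neighborFinset v).filter (· ∈ C)) (f := x)
    have h4 : 0 ≤ ∑ u ∈ (G.neighborFinset v).filter (· ∈ S) ∩
        (G.neighborFinset v).filter (· ∈ C), x u := Finset.sum_nonneg fun u _ => hx.nonneg u
    linarith [hCw v ((hEm v).1 hv).1]
  obtain ⟨v, hvE, hv⟩ := exists_light_vertex hsp hx (E := E)
    ⟨v₀, (hEm v₀).2 ⟨hv₀S, fun h => hv₀ (mem_commonNbrs.1 h s₀ hs₀)⟩⟩ (by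
      rw [Fintype.card_fin]
      refine lt_of_le_of_lt ?_ hsmall
      gcongr) (by
      intro v hv
      have h1 : ∑ u ∈ (G.neighborFinset v).filter (· ∈ S), x u ≤ κ := by
        rw [← hS, ← nsmul_one, ← Finset.sum_const]
        refine (Finset.sum_le_sum_of_subset_of_nonneg (fun u hu => (Finset.mem_filter.1 hu).2)
          fun u _ _ => hx.nonneg u).trans (Finset.sum_le_sum fun u _ => hx.le_one u)
      linarith [hsplit v hv])
  obtain ⟨hvS, hvC⟩ := (hEm v).1 hvE
  have hlt : ∑ u ∈ G.neighborFinset v, x u < ∑ u ∈ S, x u := by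
    rw [hCdef, mem_commonNbrs] at hvC
    push Not at hvC
    obtain ⟨s, hs, hsv⟩ := hvC
    have h1 : (G.neighborFinset v).filter (· ∈ S) ⊆ S.erase s := by
      intro u hu
      obtain ⟨h2, h3⟩ := Finset.mem_filter.1 hu
      refine Finset.mem_erase.2 ⟨?_, h3⟩
      rintro rfl
      exact hsv ((G.mem_neighborFinset v u).1 h2).symm
    have h2 := Finset.sum_le_sum_of_subset_of_nonneg h1 (f := x) fun u _ _ => hx.nonneg u
    have h3 := Finset.add_sum_erase S x hs
    rw [← Finset.sum_filter_add_sum_filter_not (G.neighborFinset v) (· ∈ E)]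
    linarith [hsplit v hvE, hSx s hs]
  have : Nonempty (Fin n) := ⟨v⟩
  obtain ⟨z, hz⟩ := hx.exists_eq_one
  have hpos : 0 < ∑ v, x v ^ 2 :=
    Finset.sum_pos' (fun _ _ => sq_nonneg _) ⟨z, Finset.mem_univ z, by rw [hz]; norm_num⟩
  have hform : graphIndex G * ∑ v, x v ^ 2 ≤ adjForm (rewire G S v) x := by
    rw [adjForm_rewire G hvS]
    have h1 : adjForm G x = graphIndex G * ∑ v, x v ^ 2 := by
      rw [adjForm, Finset.mul_sum]
      exact Finset.sum_congr rfl fun u _ => by rw [hx.eig]; ring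
    have h2 : 0 ≤ x v * (∑ u ∈ S, x u - ∑ u ∈ G.neighborFinset v, x u) :=
      mul_nonneg (hx.nonneg v) (by linarith)
    linarith
  refine (hmax (rewire G S v) (rewire_free hG ?_)).not_gt (lt_graphIndex hpos hform (v := v) ?_)
  · rwa [card_vertices_intersectingCycles]
  · rw [neighborFinset_rewire hvS, ← hx.eig]
    exact hlt.ne'

/-! ### Identification of the extremal graph -/

/-- If `S` is completely joined to its complement, then the complement spans at most one edge. -/
lemma edge_unique_of_free {V : Type*} [Fintype V] [DecidableEq V] {G : SimpleGraph V} {t : ℕ}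
    {k : Fin t → ℕ} (hk : ∀ i, 2 ≤ k i) {i₀ : Fin t} (hi₀ : 3 ≤ k i₀)
    (hG : (intersectingCycles fun i => 2 * k i).Free G) {S : Finset V}
    (hS : S.card = ∑ i, (k i - 1)) (hSc : 1 + ∑ i, (2 * k i - 1) ≤ Sᶜ.card)
    (hadj : ∀ v, v ∉ S → ∀ s ∈ S, G.Adj s v) {a b u w : V} (ha : a ∉ S) (hb : b ∉ S) (hu : u ∉ S)
    (hw : w ∉ S) (hab : G.Adj a b) (huw : G.Adj u w) : (u = a ∧ w = b) ∨ (u = b ∧ w = a) := by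
  have hSC : ∀ s ∈ S, ∀ c ∈ Sᶜ, G.Adj s c := fun s hs c hc => hadj c (Finset.mem_compl.1 hc) s hs
  have hpath : ∀ a b c, a ∉ S → b ∉ S → c ∉ S → G.Adj a b → G.Adj b c → a = c := by
    intro a b c ha hb hc hab hbc
    by_contra h
    exact hG (intersectingCycles_isContained_of_path hk i₀ S Sᶜ hS hSc hSC
      (Finset.mem_compl.2 ha) (Finset.mem_compl.2 hb) (Finset.mem_compl.2 hc) hab hbc h)
  by_cases h1 : u = a
  · subst h1
    exact Or.inl ⟨rfl, hpath w u b hw hu hb huw.symm hab⟩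
  by_cases h2 : u = b
  · subst h2
    exact Or.inr ⟨rfl, hpath w u a hw hu ha huw.symm hab.symm⟩
  by_cases h3 : w = a
  · subst h3
    exact absurd (hpath u w b hu hw hb huw hab) h2
  by_cases h4 : w = b
  · subst h4
    exact absurd (hpath u w a hu hw ha huw hab.symm) h1
  exact absurd (intersectingCycles_isContained_of_two_edges hk i₀ hi₀ S Sᶜ hS hSc hSC
    (Finset.mem_compl.2 ha) (Finset.mem_compl.2 hb) (Finset.mem_compl.2 hu)
    (Finset.mem_compl.2 hw) hab huw (Ne.symm h1) (Ne.symm h3) (Ne.symm h2) (Ne.symm h4)) hG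

/-- A graph with at most one edge outside a set `S` of `κ` vertices is isomorphic to a subgraph
of `S⁺`. -/
lemma exists_equiv_le_splitGraphPlus {n κ : ℕ} {G : SimpleGraph (Fin n)} {S : Finset (Fin n)}
    (hS : S.card = κ) (hn : κ + 2 ≤ n)
    (huniq : ∀ a b u w, a ∉ S → b ∉ S → u ∉ S → w ∉ S → G.Adj a b → G.Adj u w →
      (u = a ∧ w = b) ∨ (u = b ∧ w = a)) :
    ∃ e : Fin n ≃ Fin n, ∀ u w, G.Adj u w → (splitGraphPlus n κ).Adj (e u) (e w) := by
  have hpair : ∃ a b, a ∉ S ∧ b ∉ S ∧ a ≠ b ∧ ∀ u w, u ∉ S → w ∉ S → G.Adj u w →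
      (u = a ∧ w = b) ∨ (u = b ∧ w = a) := by
    by_cases h : ∃ a b, a ∉ S ∧ b ∉ S ∧ G.Adj a b
    · obtain ⟨a, b, ha, hb, hab⟩ := h
      exact ⟨a, b, ha, hb, hab.ne, fun u w hu hw huw => huniq a b u w ha hb hu hw hab huw⟩
    · have h1 : 1 < Sᶜ.card := by rw [Finset.card_compl, Fintype.card_fin]; omega
      obtain ⟨a, ha, b, hb, hab⟩ := Finset.one_lt_card.1 h1
      push Not at h
      exact ⟨a, b, Finset.mem_compl.1 ha, Finset.mem_compl.1 hb, hab,
        fun u w hu hw huw => absurd huw (h u w hu hw)⟩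
  obtain ⟨a, b, ha, hb, hab, huw⟩ := hpair
  let eS := S.equivFinOfCardEq hS
  let f : Fin n → Fin n := fun v => if h : v ∈ S then ⟨eS ⟨v, h⟩, by have := (eS ⟨v, h⟩).2; omega⟩
    else if v = a then ⟨κ, by omega⟩ else ⟨κ + 1, by omega⟩
  have hfS : ∀ v (hv : v ∈ S), (f v).val = (eS ⟨v, hv⟩).val := fun v hv => by simp [f, hv]
  have hfa : (f a).val = κ := by simp [f, ha]
  have hfb : (f b).val = κ + 1 := by simp [f, hb, hab.symm]
  have hfS' : ∀ v, v ∈ S → (f v).val < κ := fun v hv => by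
    rw [hfS v hv]; exact (eS ⟨v, hv⟩).2
  have hinj : Set.InjOn f (insert a (insert b S) : Finset (Fin n)) := by
    intro u hu w hw h
    have h' : (f u).val = (f w).val := congrArg _ h
    simp only [Finset.coe_insert, Set.mem_insert_iff, Finset.mem_coe] at hu hw
    rcases hu with rfl | rfl | hu <;> rcases hw with rfl | rfl | hw
    · rfl
    · omega
    · have := hfS' w hw; omega
    · omega
    · rfl
    · have := hfS' w hw; omega
    · have := hfS' u hu; omega
    · have := hfS' u hu; omega
    · rw [hfS u hu, hfS w hw] at h'
      have := eS.injective (Fin.ext h')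
      simpa using this
  obtain ⟨g, hg⟩ := Finset.exists_equiv_extend_of_card_eq (t := Finset.univ)
    (Finset.card_univ (α := Fin n)).symm (Finset.subset_univ _) hinj
  refine ⟨g.trans (Equiv.subtypeUnivEquiv Finset.mem_univ), fun u w h => ?_⟩
  have hval : ∀ v ∈ insert a (insert b S),
      (g.trans (Equiv.subtypeUnivEquiv Finset.mem_univ)) v = f v := fun v hv => hg v hv
  have hSv : ∀ v ∈ S, ((g.trans (Equiv.subtypeUnivEquiv Finset.mem_univ)) v).val < κ := by
    intro v hv
    rw [hval v (by simp [hv])]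
    exact hfS' v hv
  refine splitGraphPlus_adj.2 ⟨fun e => h.ne (Equiv.injective _ e), ?_⟩
  by_cases hu : u ∈ S
  · exact Or.inl (hSv u hu)
  by_cases hw : w ∈ S
  · exact Or.inr (Or.inl (hSv w hw))
  rcases huw u w hu hw h with ⟨rfl, rfl⟩ | ⟨rfl, rfl⟩
  · rw [hval u (by simp), hval w (by simp)]
    exact Or.inr (Or.inr (Or.inl ⟨hfa, hfb⟩))
  · rw [hval u (by simp), hval w (by simp)]
    exact Or.inr (Or.inr (Or.inr ⟨hfa, hfb⟩))

/-- The spectral radius of a graph with a positive eigenvector grows when edges are added. -/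
lemma eq_of_le_of_graphIndex_le {V : Type*} [Fintype V] {G H : SimpleGraph V}
    [DecidableRel G.Adj] [DecidableRel H.Adj] (hGH : G ≤ H) {μ : ℝ} {x : V → ℝ}
    (hx : ∀ v, 0 < x v) (heig : ∀ v, ∑ u ∈ G.neighborFinset v, x u = μ * x v)
    (hμ : graphIndex H ≤ μ) : G = H := by
  classical
  refine le_antisymm hGH fun a b hab => ?_
  by_contra hnot
  have hsub : ∀ v, G.neighborFinset v ⊆ H.neighborFinset v := fun v u hu => by
    rw [SimpleGraph.mem_neighborFinset] at *
    exact hGH hu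
  have hle : ∀ v, μ * x v ≤ ∑ u ∈ H.neighborFinset v, x u := fun v => by
    rw [← heig]
    exact Finset.sum_le_sum_of_subset_of_nonneg (hsub v) fun u _ _ => (hx u).le
  have : Nonempty V := ⟨a⟩
  refine hμ.not_gt (lt_graphIndex (x := x) (v := a) ?_ ?_ ?_)
  · exact Finset.sum_pos (fun v _ => pow_pos (hx v) 2) Finset.univ_nonempty
  · rw [adjForm, Finset.mul_sum]
    refine Finset.sum_le_sum fun v _ => ?_
    have := mul_le_mul_of_nonneg_left (hle v) (hx v).le
    linarith
  · rw [← heig]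
    refine ne_of_gt (Finset.sum_lt_sum_of_subset (hsub a) (i := b) ?_ ?_ (hx b)
      fun u _ _ => (hx u).le)
    · simpa using hab
    · simpa using hnot

/-- For large `n`, a graph of maximum spectral radius among the graphs without intersecting cycles
is isomorphic to `S⁺`. -/
lemma iso_of_extremal {t : ℕ} {k : Fin t → ℕ} (hk : ∀ i, 2 ≤ k i) {i₀ : Fin t} (hi₀ : 3 ≤ k i₀)
    {κ : ℕ} (hκ : κ = ∑ i, (k i - 1)) :
    ∃ N : ℕ, κ + 2 ≤ N ∧ ∀ n, N ≤ n → ∀ G : SimpleGraph (Fin n),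
      (intersectingCycles fun i => 2 * k i).Free G →
      (∀ H : SimpleGraph (Fin n), (intersectingCycles fun i => 2 * k i).Free H →
        graphIndex H ≤ graphIndex G) → Nonempty (G ≃g splitGraphPlus n κ) := by
  classical
  have hκ2 : 2 ≤ κ := by
    rw [hκ]
    exact le_trans (by omega) (Finset.single_le_sum (f := fun i => k i - 1) (fun _ _ => by simp)
      (Finset.mem_univ i₀))
  set M : ℕ := 1 + ∑ i, (2 * k i - 1) with hM
  have hM1 : (1 : ℝ) ≤ M := Nat.one_le_cast.2 (Nat.le_add_right 1 _)
  have hκ2' : (2 : ℝ) ≤ κ := by exact_mod_cast hκ2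
  set θ : ℝ := 1 / (16 * M * (2 * κ + 3) ^ 2) with hθdef
  have hθ : 0 < θ := by positivity
  have hθM : θ * (16 * M * (2 * κ + 3) ^ 2) = 1 := by rw [hθdef]; field_simp
  have hθκ : θ * (4 * (κ + 1)) ≤ 1 := by
    rw [← hθM]
    refine mul_le_mul_of_nonneg_left ?_ hθ.le
    nlinarith
  have hθM' : M * ((2 * κ + 1) * θ) ≤ 1 / 4 := by
    have : θ * (4 * M * (2 * κ + 1)) ≤ θ * (16 * M * (2 * κ + 3) ^ 2) := by
      refine mul_le_mul_of_nonneg_left ?_ hθ.le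
      have h1 : (2 * κ + 1 : ℝ) ≤ 4 * (2 * κ + 3) ^ 2 := by nlinarith
      have h2 := mul_le_mul_of_nonneg_left h1 (show (0 : ℝ) ≤ 4 * M by positivity)
      linarith
    linarith
  obtain ⟨N₁, hN₁⟩ := exists_dominating_set hk hκ hκ2 hθ hθκ
  refine ⟨max N₁ (max (2 * M + 1) (2 * κ + 2)), by simp; omega, fun n hn G hG hmax => ?_⟩
  simp only [max_le_iff] at hn
  obtain ⟨hn1, hn2, hn3⟩ := hn
  have hn2' : (2 * M + 1 : ℝ) ≤ n := by exact_mod_cast hn2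
  have hn3' : (2 * κ + 2 : ℝ) ≤ n := by exact_mod_cast hn3
  have : Nonempty (Fin n) := ⟨⟨0, by omega⟩⟩
  have hplus : graphIndex (splitGraphPlus n κ) ≤ graphIndex G := by
    refine hmax _ ?_
    rw [hκ]
    exact splitGraphPlus_free hk i₀ n
  obtain ⟨x, hx0, hx1, hxz, hxe⟩ := exists_perron G
  have hx : IsPerron G κ (graphIndex G) x := by
    refine ⟨hx0, hx1, hxz, hxe, graphIndex_nonneg G, ?_⟩
    rw [Fintype.card_fin]
    exact (le_sq_graphIndex_splitGraphPlus (by omega) (by omega)).trans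
      (pow_le_pow_left₀ (graphIndex_nonneg _) hplus 2)
  obtain ⟨S, hS, hSx, hSC, hSout⟩ := hN₁ n hn1 G hG _ x hx
  have hθ8 : θ ≤ 1 / 8 := by nlinarith
  have hadj : ∀ v, v ∉ S → ∀ s ∈ S, G.Adj s v := by
    refine adj_of_extremal hk hκ hG hmax hx hS (fun s hs => ?_) (fun v hv => ?_) ?_ ?_
    · linarith [hSx s hs]
    · exact (mul_le_mul_of_nonneg_left (hSout v hv) (by linarith)).trans hθM'
    · have h1 : θ * (4 * (κ + 1)) * n ≤ 1 * n := mul_le_mul_of_nonneg_right hθκ (by linarith)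
      have h2 : 0 < θ * n := mul_pos hθ (by linarith)
      have h3 : (M : ℝ) < (commonNbrs G S).card := by linarith
      exact Nat.cast_lt.1 h3
    · have h1 : (2 * κ + 3 : ℝ) ^ 2 * (2 * ((2 * M : ℕ) : ℝ) * (n - (commonNbrs G S).card)) ≤
          (2 * κ + 3) ^ 2 * (2 * ((2 * M : ℕ) : ℝ) * (κ * (2 * θ * n))) := by
        gcongr
        linarith
      refine h1.trans_lt ?_
      have h2 : (2 * κ + 3 : ℝ) ^ 2 * (2 * ((2 * M : ℕ) : ℝ) * (κ * (2 * θ * n))) =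
          θ * (16 * M * (2 * κ + 3) ^ 2) * (κ * n / 2) := by
        push_cast
        ring
      rw [h2, hθM]
      nlinarith
  have hScard : M ≤ Sᶜ.card := by
    rw [Finset.card_compl, Fintype.card_fin, hS]
    omega
  obtain ⟨e, he⟩ := exists_equiv_le_splitGraphPlus hS (by omega) fun a b u w ha hb hu hw h1 h2 =>
    edge_unique_of_free hk hi₀ hG (hS.trans hκ) hScard hadj ha hb hu hw h1 h2
  have hxpos : ∀ v, 0 < x v := by
    intro v
    by_cases hv : v ∈ S
    · linarith [hSx v hv]
    · obtain ⟨s, hs⟩ : S.Nonempty := Finset.card_pos.1 (by omega)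
      refine (hx0 v).lt_of_ne fun h0 => ?_
      have h1 := hxe v
      rw [← h0, mul_zero] at h1
      have h2 := (Finset.sum_eq_zero_iff_of_nonneg fun u _ => hx0 u).1 h1 s
        (by simpa using (hadj v hv s hs).symm)
      linarith [hSx s hs]
  have heq : G = (splitGraphPlus n κ).comap e := by
    refine eq_of_le_of_graphIndex_le (fun u w h => he u w h) hxpos hxe ?_
    exact (graphIndex_le_of_iso (SimpleGraph.Iso.comap e (splitGraphPlus n κ))).trans hplus
  rw [heq]
  exact ⟨SimpleGraph.Iso.comap e (splitGraphPlus n κ)⟩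

theorem theorem1p4 {t : ℕ} (k : Fin t → ℕ) (hk : ∀ i, 2 ≤ k i)
    (hmax : 3 ≤ Finset.univ.sup k) (κ : ℕ) (hκ : κ = ∑ i, (k i - 1)) :
    ∃ N : ℕ, ∀ n : ℕ, N ≤ n →
      (∀ G : SimpleGraph (Fin n),
        adjSpectralRadius (splitGraphPlus n κ) ≤ adjSpectralRadius G →
        ¬ Nonempty (G ≃g splitGraphPlus n κ) →
        (intersectingCycles fun i => 2 * k i).IsContained G) ∧
      SPEX n (intersectingCycles fun i => 2 * k i) =
        {G | Nonempty (G ≃g splitGraphPlus n κ)} := by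
  obtain ⟨i₀, -, hi₀⟩ := (Finset.le_sup_iff (by simp : (⊥ : ℕ) < 3)).1 hmax
  obtain ⟨N, hNκ, hN⟩ := iso_of_extremal hk hi₀ hκ
  refine ⟨N, fun n hn => ?_⟩
  have : Nonempty (Fin n) := ⟨⟨0, by omega⟩⟩
  set F := intersectingCycles fun i => 2 * k i with hF
  have hfree : F.Free (splitGraphPlus n κ) := by
    rw [hκ]
    exact splitGraphPlus_free hk i₀ n
  have hle : ∀ H : SimpleGraph (Fin n), F.Free H →
      adjSpectralRadius H ≤ adjSpectralRadius (splitGraphPlus n κ) := by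
    obtain ⟨G, hG, hGmax⟩ := Set.exists_max_image {H : SimpleGraph (Fin n) | F.Free H} graphIndex
      (Set.toFinite _) ⟨_, hfree⟩
    obtain ⟨e⟩ := hN n hn G hG hGmax
    intro H hH
    rw [← adjSpectralRadius_eq_of_iso e]
    exact adjSpectralRadius_le_iff.2 (hGmax H hH)
  have hiso : ∀ G : SimpleGraph (Fin n), F.Free G →
      adjSpectralRadius (splitGraphPlus n κ) ≤ adjSpectralRadius G →
      Nonempty (G ≃g splitGraphPlus n κ) := fun G hG h =>
    hN n hn G hG fun H hH => adjSpectralRadius_le_iff.1 ((hle H hH).trans h)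
  have hspex : spex n F = adjSpectralRadius (splitGraphPlus n κ) :=
    le_antisymm (iSup₂_le hle) (le_iSup₂ (f := fun (G : SimpleGraph (Fin n))
      (_ : G ∈ {G : SimpleGraph (Fin n) | F.Free G}) => adjSpectralRadius G) _ hfree)
  refine ⟨fun G h hnot => ?_, ?_⟩
  · by_contra hG
    exact hnot (hiso G hG h)
  · ext G
    constructor
    · rintro ⟨hG, h⟩
      exact hiso G hG (h.trans hspex).ge
    · rintro ⟨e⟩
      refine ⟨fun h => hfree (h.trans ⟨e.toCopy⟩), ?_⟩
      rw [hspex, adjSpectralRadius_eq_of_iso e]
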